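/- Let $\Sigma$ be a finite alphabet with at least two symbols. A bounded pushdown transducer is a deterministic machine with finitely many states and a stack over a finite alphabet $\Gamma$, started in a state $q_0$ with stack $z_0\in\Gamma$. It reads its input from left to right. Depending on state, input symbol and top stack symbol, each input symbol is either rejected, or it changes the state, replaces the top stack symbol by a word over $\Gamma$, and writes a word to the output. Moreover there may be $\lambda$-rules, which read no input, write no output, and just pop the top stack symbol and change the state; for each state and top stack symbol, a $\lambda$-rule and a reading rule are never both available. $\lambda$-rules are applied as long as possible, and at most $c$ times after each input symbol, for a constant $c$ of the machine. The symbol $z_0$ is never removed from the bottom of the stack. An invertible pushdown compressor (invPD) is a pair $(C,D)$ of bounded pushdown transducers such that, on every $w\in\Sigma^*$, $C$ is defined with output $C(w)\in\Sigma^*$ and final state $q(w)$, the map $w\mapsto(C(w),q(w))$ is one-to-one, and $D$, on input $C(w)$ followed by $q(w)$, outputs $w$. For $T:\Sigma^*\to\Sigma^*$ and $S\in\Sigma^\infty$ let $\rho_T(S)=\liminf_{n\to\infty}|T(S[1..n])|/n$ and $R_T(S)=\limsup_{n\to\infty}|T(S[1..n])|/n$ (values in $[0,\infty]$), and let $R_{\mathrm{invPD}}(S)=\inf\{R_C(S)\mid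 (C,D)\text{ is an invPD for some }D\}$. LZ (the LZ78 algorithm) parses $x\in\Sigma^*$ from left to right as $x=x_1\cdots x_m$, where each phrase $x_i$ is the shortest prefix of the remaining input that is nonempty and not among $x_1,\dots,x_{i-1}$ (the last phrase may be an old one, if no such prefix exists). So $x_i=x_{l(i)}b_i$ with $l(i)<i$, $b_i\in\Sigma$ and $x_0$ the empty word. Its output is $LZ(x)=c_{l(1)}b_1\cdots c_{l(m)}b_m$, where $(c_i)_{i\ge 0}$ is a prefix-free code of the natural numbers by words over $\Sigma$. Theorem. For every $\epsilon>0$ there is a sequence $S\in\Sigma^\infty$ such that $$R_{\mathrm{invPD}}(S)\le\tfrac12$$ and, for every choice of the prefix-free code used by LZ, $$\rho_{LZ}(S)>1-\epsilon.$$ -/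

import Mathlib

open Filter

/-! ### Pushdown transducers -/

/-- A deterministic pushdown transducer with input alphabet `I` and output alphabet `O`.
`none` means that the transition is undefined. The transition function is split according to
whether an input symbol is consumed: `pop q a = some q'` is the rule that, in state `q` with `a` on
top of the stack, consumes no input, pops `a` and moves to `q'` (a lambda-rule);
`read q b a = some (q', v)` consumes `b`, replaces the top symbol `a` by the word `v` and
moves to `q'`. The top of the stack is the head of the list. -/
structure PushdownTransducer (I : Type*) (O : Type*) where
  /-- states -/
  Q : Type
  /-- stack alphabet -/
  Γ : Type
  finite_Q : Finite Q
  finite_Γ : Finite Γ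
  pop : Q → Γ → Option Q
  read : Q → I → Γ → Option (Q × List Γ)
  /-- output function -/
  out : Q → I → Γ → List O
  /-- initial state -/
  q₀ : Q
  /-- start stack symbol -/
  z₀ : Γ
  /-- `z₀` cannot be removed from the bottom of the stack by a lambda-rule ... -/
  pop_bottom : ∀ q, pop q z₀ = none
  /-- ... nor by a rule that consumes a symbol. -/
  read_bottom : ∀ q b r, read q b z₀ = some r → ∃ v : List Γ, r.2 = v ++ [z₀]
  /-- a lambda-rule and a rule that consumes a symbol never compete -/
  deterministic : ∀ q a, pop q a = none ∨ ∀ b, read q b a = none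

namespace PushdownTransducer

variable {I O : Type*} (M : PushdownTransducer I O)

/-- Apply lambda-rules as long as possible. -/
def popAll : M.Q → List M.Γ → M.Q × List M.Γ
  | q, [] => (q, [])
  | q, a :: s =>
    match M.pop q a with
    | some q' => popAll q' s
    | none => (q, a :: s)

/-- The number of lambda-rules applied by `popAll`. -/
def popCount : M.Q → List M.Γ → ℕ
  | _, [] => 0
  | q, a :: s =>
    match M.pop q a with
    | some q' => popCount q' s + 1
    | none => 0

/-- Consume one input symbol, then apply lambda-rules as long as possible; the result is the new
configuration (state and stack) together with the word that was output. -/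
def step : M.Q × List M.Γ → I → Option ((M.Q × List M.Γ) × List O)
  | (_, []), _ => none
  | (q, a :: s), b =>
    match M.read q b a with
    | some (q', v) => some (M.popAll q' (v ++ s), M.out q b a)
    | none => none

/-- Run on an input word from a given configuration; `none` if the machine gets stuck. -/
def runFrom : M.Q × List M.Γ → List I → Option ((M.Q × List M.Γ) × List O)
  | cfg, [] => some (cfg, [])
  | cfg, b :: w =>
    match M.step cfg b with
    | some (cfg', o) =>
      match runFrom cfg' w with
      | some (cfg'', o') => some (cfg'', o ++ o')
      | none => none
    | none => none

/-- Run on an input word from the initial configuration. -/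
def run (w : List I) : Option ((M.Q × List M.Γ) × List O) :=
  M.runFrom (M.popAll M.q₀ [M.z₀]) w

/-- The output and the final state on input `w`. -/
def result (w : List I) : Option (List O × M.Q) :=
  (M.run w).map fun r => (r.2, r.1.1)

/-- The output on input `w` (the empty word if the machine gets stuck). -/
def output (w : List I) : List O :=
  ((M.result w).map Prod.fst).getD []

/-- In every run from the initial configuration, at most `c` lambda-rules are applied after each
input symbol. -/
def LambdaBounded (c : ℕ) : Prop :=
  ∀ (w : List I) (q : M.Q) (a : M.Γ) (s : List M.Γ) (o : List O),
    M.run w = some ((q, a :: s), o) →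
    ∀ (b : I) (q' : M.Q) (v : List M.Γ),
      M.read q b a = some (q', v) → M.popCount q' (v ++ s) ≤ c

end PushdownTransducer

/-- A pushdown transducer with an upper bound `c` on the number of lambda-rules per input symbol.
A bounded pushdown compressor over `A` is an element of `BoundedPDT A A`. -/
structure BoundedPDT (I : Type*) (O : Type*) extends PushdownTransducer I O where
  c : ℕ
  lambdaBounded : toPushdownTransducer.LambdaBounded c

/-- `C` is information-lossless: output and final state are defined on every input word, and
together they determine the input word. -/
def BoundedPDT.IsIL {A : Type*} (C : BoundedPDT A A) : Prop :=
  (∀ w, (C.result w).isSome) ∧ Function.Injective C.result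

/-- `(C, D)` is an invertible pushdown compressor: `C` is information-lossless, and the pushdown
transducer `D`, given the output `C(w)` followed by the final state of `C` on `w`, outputs `w`. -/
def IsInvPD {A : Type*} (C : BoundedPDT A A) (D : BoundedPDT (A ⊕ C.Q) A) : Prop :=
  C.IsIL ∧ ∀ (w x : List A) (q : C.Q), C.result w = some (x, q) →
    (D.result (x.map Sum.inl ++ [Sum.inr q])).map Prod.fst = some w

/-! ### Compression ratios of sequences -/

/-- The first `n` symbols of the sequence `S`. -/
def seqPrefix {A : Type*} (S : ℕ → A) (n : ℕ) : List A := (List.range n).map S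

/-- The ratio `|T(S[1..n])| / n`. -/
noncomputable def prefixRatio {A : Type*} (T : List A → List A) (S : ℕ → A) (n : ℕ) : EReal :=
  (((T (seqPrefix S n)).length / n : ℝ) : EReal)

/-- `ρ_T(S)` -/
noncomputable def lowerRatio {A : Type*} (T : List A → List A) (S : ℕ → A) : EReal :=
  liminf (prefixRatio T S) atTop

/-- `R_T(S)` -/
noncomputable def upperRatio {A : Type*} (T : List A → List A) (S : ℕ → A) : EReal :=
  limsup (prefixRatio T S) atTop

/-- `R_invPD(S)`, the worst-case invertible pushdown compression ratio. -/
noncomputable def upperRatioInvPD {A : Type*} (S : ℕ → A) : EReal :=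
  sInf {r | ∃ (C : BoundedPDT A A) (D : BoundedPDT (A ⊕ C.Q) A),
    IsInvPD C D ∧ r = upperRatio C.output S}

/-! ### The Lempel-Ziv (LZ78) algorithm -/

/-- The phrases into which the remaining input is parsed, when `dict` lists the phrases found so
far and `cur` is the part of the current phrase that has already been read. A phrase ends as soon as
it is not in the dictionary; only the last phrase of the input may be an old one. -/
def lzPhrasesAux {A : Type*} [DecidableEq A] :
    List (List A) → List A → List A → List (List A)
  | _, cur, [] => if cur = [] then [] else [cur]
  | dict, cur, b :: w =>
    if cur ++ [b] ∈ dict then lzPhrasesAux dict (cur ++ [b]) w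
    else (cur ++ [b]) :: lzPhrasesAux (dict ++ [cur ++ [b]]) [] w

/-- The parsing `x = x₁ x₂ ... xₙ`. -/
def lzPhrases {A : Type*} [DecidableEq A] (x : List A) : List (List A) := lzPhrasesAux [] [] x

/-- A prefix-free coding of the natural numbers by words over `A`. -/
def IsPrefixFreeCode {A : Type*} (code : ℕ → List A) : Prop :=
  ∀ i j, code i <+: code j → i = j

/-- The output of LZ, where the natural numbers are coded by `code`: each phrase `xᵢ = x_l b` is
replaced by `code l` followed by `b`, where `x₀` is the empty word. -/
def lzOutput {A : Type*} [DecidableEq A] (code : ℕ → List A) (x : List A) : List A :=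
  (lzPhrases x).flatMap fun p =>
    code (([] :: lzPhrases x).idxOf p.dropLast) ++ p.getLast?.toList

/-! Fix symbols `z ≠ o` and a large `h`, and enumerate by length the words `u` that do not contain
`o^h`. The sequence is `z`, `zo`, ..., `zo^h` followed by all the words `o u z o^h z u⁻¹` in the
order of the enumeration.

A pushdown machine can store `u z` on its stack in blocks of length at least `V`, recognize the
turning point by the run `o^h`, and then replace each mirrored block by a single symbol. This halves
the length up to a factor `1 + O(1/V)`. The machine is defined on all inputs because a mismatch is
flagged by `z` and everything after it is copied; its inverse runs in lockstep with it
(`exists_simulation`). The infimum over `V` gives 1/2.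

For LZ the same sequence is nearly incompressible. Having no run `o^h` is inherited by prefixes and
suffixes, so the parents of the phrases `o u` and `z o^h z u⁻¹` have always occurred before, and
each palindrome is parsed into exactly these two new phrases (`isLZParsing_phrases`). The number of
palindromes is almost maximal for their length: freely filling all positions except every `h`-th,
which is `z`, shows that `r` is at least about `k^((1-1/h)|u_r|)`, where `k` is the size of the
alphabet (`pow_le`). The outputs for different phrases are different words, and about `2r` different
words have total length about `2r log_k r` or more (`le_sum_length`), while the input has length
about `2r|u_r|` at most. So the ratio is at least `1 - 2/h` for all long prefixes. -/

namespace PushdownTransducer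

/-! ### Runs of pushdown transducers as a reachability relation -/

section Basic
variable {I O : Type*} (M : PushdownTransducer I O)

theorem popAll_eq_self (hM : ∀ q a, M.pop q a = none) (q : M.Q) (s : List M.Γ) :
    M.popAll q s = (q, s) := by
  cases s with
  | nil => rfl
  | cons a s => simp [popAll, hM]

theorem popCount_eq_zero (hM : ∀ q a, M.pop q a = none) (q : M.Q) (s : List M.Γ) :
    M.popCount q s = 0 := by
  cases s with
  | nil => rfl
  | cons a s => simp [popCount, hM]

/-- Reading `w` leads from the configuration `c` to `c'` and outputs `o`. -/
def Reaches (c : M.Q × List M.Γ) (w : List I) (c' : M.Q × List M.Γ) (o : List O) : Prop :=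
  M.runFrom c w = some (c', o)

variable {M}

theorem Reaches.refl (c : M.Q × List M.Γ) : M.Reaches c [] c [] := by
  simp [Reaches, runFrom]

theorem Reaches.cons {c c' c'' : M.Q × List M.Γ} {b : I} {w : List I} {o o' : List O}
    (h : M.step c b = some (c', o)) (h' : M.Reaches c' w c'' o') :
    M.Reaches c (b :: w) c'' (o ++ o') := by
  unfold Reaches at *
  simp [runFrom, h, h']

theorem Reaches.single {c c' : M.Q × List M.Γ} {b : I} {o : List O}
    (h : M.step c b = some (c', o)) : M.Reaches c [b] c' o := by
  simpa using Reaches.cons h (Reaches.refl c')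

theorem Reaches.exists_of_cons {c c'' : M.Q × List M.Γ} {b : I} {w : List I} {o : List O}
    (h : M.Reaches c (b :: w) c'' o) :
    ∃ c' o₁ o₂, M.step c b = some (c', o₁) ∧ M.Reaches c' w c'' o₂ ∧ o = o₁ ++ o₂ := by
  unfold Reaches at *
  simp only [runFrom] at h
  cases h1 : M.step c b with
  | none => simp [h1] at h
  | some r =>
    obtain ⟨c', o₁⟩ := r
    cases h2 : M.runFrom c' w with
    | none => simp [h1, h2] at h
    | some r' =>
      obtain ⟨d, o₂⟩ := r'
      simp only [h1, h2, Option.some.injEq, Prod.mk.injEq] at h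
      exact ⟨c', o₁, o₂, rfl, by rw [h2, h.1], h.2.symm⟩

theorem Reaches.append {c c' c'' : M.Q × List M.Γ} {w w' : List I} {o o' : List O}
    (h : M.Reaches c w c' o) (h' : M.Reaches c' w' c'' o') :
    M.Reaches c (w ++ w') c'' (o ++ o') := by
  induction w generalizing c o with
  | nil =>
    simp only [Reaches, runFrom, Option.some.injEq, Prod.mk.injEq] at h
    obtain ⟨rfl, rfl⟩ := h
    simpa using h'
  | cons b w ih =>
    obtain ⟨d, o₁, o₂, h1, h2, rfl⟩ := h.exists_of_cons
    simpa using Reaches.cons h1 (ih h2)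

theorem Reaches.exists_of_append {c c'' : M.Q × List M.Γ} {w w' : List I} {o : List O}
    (h : M.Reaches c (w ++ w') c'' o) :
    ∃ c' o₁ o₂, M.Reaches c w c' o₁ ∧ M.Reaches c' w' c'' o₂ ∧ o = o₁ ++ o₂ := by
  induction w generalizing c o with
  | nil => exact ⟨c, [], o, .refl c, h, rfl⟩
  | cons b w ih =>
    obtain ⟨d, o₁, o₂, h1, h2, rfl⟩ := h.exists_of_cons
    obtain ⟨c', o₃, o₄, h3, h4, rfl⟩ := ih h2
    exact ⟨c', _, o₄, .cons h1 h3, h4, by simp⟩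

theorem Reaches.length_le {c c' : M.Q × List M.Γ} {w : List I} {o : List O} {K : ℕ}
    (hK : ∀ q b a, (M.out q b a).length ≤ K) (h : M.Reaches c w c' o) :
    o.length ≤ K * w.length := by
  induction w generalizing c o with
  | nil =>
    simp only [Reaches, runFrom, Option.some.injEq, Prod.mk.injEq] at h
    simp [← h.2]
  | cons b w ih =>
    obtain ⟨d, o₁, o₂, h1, h2, rfl⟩ := h.exists_of_cons
    have h3 := ih h2
    have h4 : o₁.length ≤ K := by
      obtain ⟨q, s⟩ := c
      cases s with
      | nil => simp [step] at h1
      | cons a s =>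
        simp only [step] at h1
        cases h5 : M.read q b a with
        | none => simp [h5] at h1
        | some r =>
          simp only [h5, Option.some.injEq, Prod.mk.injEq] at h1
          rw [← h1.2]
          exact hK q b a
    simp only [List.length_append, List.length_cons]
    nlinarith

theorem step_eq (hM : ∀ q a, M.pop q a = none) {q q' : M.Q} {a : M.Γ} {s v : List M.Γ} {b : I}
    (h : M.read q b a = some (q', v)) :
    M.step (q, a :: s) b = some ((q', v ++ s), M.out q b a) := by
  simp [step, h, popAll_eq_self M hM]

theorem run_eq (hM : ∀ q a, M.pop q a = none) {w : List I} {c : M.Q × List M.Γ} {o : List O} :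
    M.run w = some (c, o) ↔ M.Reaches (M.q₀, [M.z₀]) w c o := by
  simp [run, Reaches, popAll_eq_self M hM]

end Basic

end PushdownTransducer

/-! ### The palindrome compressor -/

namespace Palindrome

/-- Words over `A` of length at most `B`, as a type in the lowest universe. -/
def Buf (A : Type*) [Fintype A] (B : ℕ) : Type := Shrink.{0} {l : List A // l.length ≤ B}

/-- The modes of the palindrome compressor. -/
inductive Mode
  | copy
  | err
  | push
  | pop

instance : Finite Mode :=
  Finite.of_surjective (fun i : Fin 4 => ![Mode.copy, Mode.err, Mode.push, Mode.pop] i) (by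
    rintro (_ | _ | _ | _)
    exacts [⟨0, rfl⟩, ⟨1, rfl⟩, ⟨2, rfl⟩, ⟨3, rfl⟩])

section
variable {A : Type*} [Fintype A]

instance (B : ℕ) : Finite (Buf A B) :=
  have : Finite {l : List A // l.length ≤ B} := List.finite_length_le A B
  Finite.of_equiv _ (equivShrink.{0} {l : List A // l.length ≤ B})

/-- The word stored in a buffer. -/
noncomputable def Buf.val {B : ℕ} (x : Buf A B) : List A :=
  ((equivShrink.{0} {l : List A // l.length ≤ B}).symm x).1

/-- The buffer that stores the first `B` symbols of a word. -/
noncomputable def Buf.mk {B : ℕ} (l : List A) : Buf A B :=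
  equivShrink.{0} {l : List A // l.length ≤ B} ⟨l.take B, by simp⟩

theorem Buf.val_mk {B : ℕ} {l : List A} (h : l.length ≤ B) : (Buf.mk l : Buf A B).val = l := by
  simp [Buf.val, Buf.mk, h]

@[simp]
theorem Buf.val_mk_nil {B : ℕ} : (Buf.mk [] : Buf A B).val = [] := Buf.val_mk (by simp)

theorem Buf.length_val {B : ℕ} (x : Buf A B) : x.val.length ≤ B :=
  ((equivShrink.{0} {l : List A // l.length ≤ B}).symm x).2

end

open Classical in
/-- The transition of compressor and decompressor where the input is copied to the output. The
first `s` symbols are ignored; in mode `push` the input is stored on the stack in blocks of length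
at least `V`, until `h` consecutive occurrences of `o` announce the mirror image. -/
noncomputable def copyStep {A : Type*} [Fintype A] {B : ℕ} (o : A) (h V s : ℕ) (m : Mode)
    (l : List A) (b : A) (T : Buf A B) : (Mode × Buf A B) × List (Buf A B) :=
  match m with
  | .copy => (if (l ++ [b]).length < s then (.copy, .mk (l ++ [b])) else (.pop, .mk []), [T])
  | .err => ((.err, .mk []), [T])
  | .push =>
    if List.replicate h o <:+ l ++ [b] then
      ((.pop, .mk []),
        if (l ++ [b]).take ((l ++ [b]).length - h) = [] then [T]
        else [.mk ((l ++ [b]).take ((l ++ [b]).length - h)), T])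
    else if b ≠ o ∧ V ≤ (l ++ [b]).length then ((.push, .mk []), [.mk (l ++ [b]), T])
    else ((.push, .mk (l ++ [b])), [T])
  -- Used at the bottom of the stack only: a new palindrome starts, and its first symbol is copied
  -- without being stored.
  | .pop => ((.push, .mk []), [T])

/-- Copying never removes the top symbol, so the bottom marker survives in both machines. -/
theorem copyStep_stack {A : Type*} [Fintype A] {B : ℕ} (o : A) (h V s : ℕ) (m : Mode)
    (l : List A) (b : A) (T : Buf A B) : ∃ v, (copyStep o h V s m l b T).2 = v ++ [T] := by
  cases m <;> simp only [copyStep]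
  · exact ⟨[], rfl⟩
  · exact ⟨[], rfl⟩
  · split_ifs
    · exact ⟨[], rfl⟩
    · exact ⟨[_], rfl⟩
    · exact ⟨[_], rfl⟩
    · exact ⟨[], rfl⟩
  · exact ⟨[], rfl⟩

theorem copyStep_pop {A : Type*} [Fintype A] {B : ℕ} (o : A) (h V s : ℕ) (m : Mode)
    (l : List A) (b : A) (T : Buf A B) (hm : (copyStep o h V s m l b T).1.1 = .pop) :
    (copyStep o h V s m l b T).1.2 = .mk [] := by
  revert hm
  cases m <;> simp only [copyStep] <;> (try split_ifs) <;> simp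

open Classical in
/-- The palindrome compressor: a stored block whose mirror image is read is replaced by the single
symbol `o`; in case of a mismatch the marker `z` is written and the input is copied from then on. -/
noncomputable def compressor {A : Type*} [Fintype A] (o z : A) (h V s B : ℕ) :
    BoundedPDT A A where
  Q := Mode × Buf A B
  Γ := Buf A B
  finite_Q := inferInstance
  finite_Γ := inferInstance
  pop _ _ := none
  read q b T := some (if q.1 = .pop ∧ T.val ≠ [] then
      if (q.2.val ++ [b]).length < T.val.length then ((.pop, .mk (q.2.val ++ [b])), [T])
      else if q.2.val ++ [b] = T.val.reverse then ((.pop, .mk []), [])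
      else ((.err, .mk []), [T])
    else copyStep o h V s q.1 q.2.val b T)
  out q b T := if q.1 = .pop ∧ T.val ≠ [] then
      if (q.2.val ++ [b]).length < T.val.length then []
      else if q.2.val ++ [b] = T.val.reverse then [o]
      else z :: (q.2.val ++ [b])
    else [b]
  q₀ := (.copy, .mk [])
  z₀ := .mk []
  pop_bottom _ := rfl
  read_bottom q b r hr := by
    simp only [Buf.val_mk_nil, ne_eq, not_true_eq_false, and_false, if_false,
      Option.some.injEq] at hr
    subst hr
    exact copyStep_stack ..
  deterministic _ _ := Or.inl rfl
  c := 0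
  lambdaBounded := by
    intro w q a s o' _ b q' v _
    exact (PushdownTransducer.popCount_eq_zero _ (fun _ _ => rfl) _ _).le

open Classical in
/-- The inverse of the palindrome compressor. -/
noncomputable def decompressor {A : Type*} [Fintype A] (o z : A) (h V s B : ℕ) :
    BoundedPDT (A ⊕ (compressor o z h V s B).Q) A where
  Q := Mode × Buf A B
  Γ := Buf A B
  finite_Q := inferInstance
  finite_Γ := inferInstance
  pop _ _ := none
  read q x T := some (match x with
    | .inl b =>
      if q.1 = .pop ∧ T.val ≠ [] then
        if b = o then ((.pop, .mk []), []) else ((.err, .mk []), [T])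
      else copyStep o h V s q.1 q.2.val b T
    | .inr _ => ((.err, .mk []), [T]))
  out q x T := match x with
    | .inl b =>
      if q.1 = .pop ∧ T.val ≠ [] then
        if b = o then T.val.reverse else []
      else [b]
    -- In mode `pop` the buffer of the compressor holds the symbols that it has read but not yet
    -- encoded; the final state supplies them.
    | .inr q' => if q'.1 = .pop then Buf.val (A := A) (B := B) q'.2 else []
  q₀ := (.copy, .mk [])
  z₀ := .mk []
  pop_bottom _ := rfl
  read_bottom q b r hr := by
    cases b with
    | inl b =>
      simp only [Buf.val_mk_nil, ne_eq, not_true_eq_false, and_false, if_false,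
        Option.some.injEq] at hr
      subst hr
      exact copyStep_stack ..
    | inr q' =>
      simp only [Option.some.injEq] at hr
      subst hr
      exact ⟨[], rfl⟩
  deterministic _ _ := Or.inl rfl
  c := 0
  lambdaBounded := by
    intro w q a s o' _ b q' v _
    exact (PushdownTransducer.popCount_eq_zero _ (fun _ _ => rfl) _ _).le

/-! ### Synchronization of compressor and decompressor -/

section
variable {A : Type*} [Fintype A] (o z : A) (h V s B : ℕ)

theorem compressor_step {q q' : Mode × Buf A B} {b : A} {T : Buf A B} {st v : List (Buf A B)}
    {x : List A} (hr : (compressor o z h V s B).read q b T = some (q', v))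
    (ho : (compressor o z h V s B).out q b T = x) :
    (compressor o z h V s B).step (q, T :: st) b = some ((q', v ++ st), x) := by
  subst ho
  exact PushdownTransducer.step_eq (M := (compressor o z h V s B).toPushdownTransducer)
    (fun _ _ => rfl) hr

theorem compressor_step_copy (m : Mode) (l : Buf A B) (b : A) (T : Buf A B)
    (st : List (Buf A B)) (hm : ¬ (m = .pop ∧ T.val ≠ [])) :
    (compressor o z h V s B).step ((m, l), T :: st) b =
      some (((copyStep o h V s m l.val b T).1, (copyStep o h V s m l.val b T).2 ++ st), [b]) :=
  compressor_step o z h V s B (congrArg some (if_neg hm)) (if_neg hm)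

theorem compressor_step_short (l : Buf A B) (b : A) (T : Buf A B)
    (st : List (Buf A B)) (hl : (l.val ++ [b]).length < T.val.length) :
    (compressor o z h V s B).step ((.pop, l), T :: st) b =
      some (((.pop, .mk (l.val ++ [b])), T :: st), []) := by
  have hT : T.val ≠ [] := by rintro h; simp [h] at hl
  exact compressor_step o z h V s B (v := [T])
    (congrArg some ((if_pos ⟨rfl, hT⟩).trans (if_pos hl))) ((if_pos ⟨rfl, hT⟩).trans (if_pos hl))

theorem compressor_step_match (l : Buf A B) (b : A) (T : Buf A B)
    (st : List (Buf A B)) (hl : l.val ++ [b] = T.val.reverse) :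
    (compressor o z h V s B).step ((.pop, l), T :: st) b = some (((.pop, .mk []), st), [o]) := by
  have hT : T.val ≠ [] := by rintro h; simp [h] at hl
  have hl' : ¬ (l.val ++ [b]).length < T.val.length := by rw [hl]; simp
  exact compressor_step o z h V s B (v := [])
    (congrArg some ((if_pos ⟨rfl, hT⟩).trans ((if_neg hl').trans (if_pos hl))))
    ((if_pos ⟨rfl, hT⟩).trans ((if_neg hl').trans (if_pos hl)))

theorem compressor_step_mismatch (l : Buf A B) (b : A) (T : Buf A B)
    (st : List (Buf A B)) (hT : T.val ≠ []) (hl' : ¬ (l.val ++ [b]).length < T.val.length)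
    (hl : l.val ++ [b] ≠ T.val.reverse) :
    (compressor o z h V s B).step ((.pop, l), T :: st) b =
      some (((.err, .mk []), T :: st), z :: (l.val ++ [b])) :=
  compressor_step o z h V s B (v := [T])
    (congrArg some ((if_pos ⟨rfl, hT⟩).trans ((if_neg hl').trans (if_neg hl))))
    ((if_pos ⟨rfl, hT⟩).trans ((if_neg hl').trans (if_neg hl)))

theorem decompressor_step {q q' : Mode × Buf A B} {b : A ⊕ (compressor o z h V s B).Q}
    {T : Buf A B} {st v : List (Buf A B)} {x : List A}
    (hr : (decompressor o z h V s B).read q b T = some (q', v))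
    (ho : (decompressor o z h V s B).out q b T = x) :
    (decompressor o z h V s B).step (q, T :: st) b = some ((q', v ++ st), x) := by
  subst ho
  exact PushdownTransducer.step_eq (M := (decompressor o z h V s B).toPushdownTransducer)
    (fun _ _ => rfl) hr

theorem decompressor_step_copy (m : Mode) (l : Buf A B) (b : A) (T : Buf A B)
    (st : List (Buf A B)) (hm : ¬ (m = .pop ∧ T.val ≠ [])) :
    (decompressor o z h V s B).step ((m, l), T :: st) (.inl b) =
      some (((copyStep o h V s m l.val b T).1, (copyStep o h V s m l.val b T).2 ++ st), [b]) :=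
  decompressor_step o z h V s B (congrArg some (if_neg hm)) (if_neg hm)

theorem decompressor_step_match (l : Buf A B) (T : Buf A B)
    (st : List (Buf A B)) (hT : T.val ≠ []) :
    (decompressor o z h V s B).step ((.pop, l), T :: st) (.inl o) =
      some (((.pop, .mk []), st), T.val.reverse) :=
  decompressor_step o z h V s B (v := [])
    (congrArg some ((if_pos ⟨rfl, hT⟩).trans (if_pos rfl))) ((if_pos ⟨rfl, hT⟩).trans (if_pos rfl))

theorem decompressor_step_mismatch (l : Buf A B) (T : Buf A B)
    (st : List (Buf A B)) (hT : T.val ≠ []) (hz : z ≠ o) :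
    (decompressor o z h V s B).step ((.pop, l), T :: st) (.inl z) =
      some (((.err, .mk []), T :: st), []) :=
  decompressor_step o z h V s B (v := [T])
    (congrArg some ((if_pos ⟨rfl, hT⟩).trans (if_neg hz))) ((if_pos ⟨rfl, hT⟩).trans (if_neg hz))

open Classical in
theorem decompressor_step_state (q : Mode × Buf A B) (q' : Mode × Buf A B) (T : Buf A B)
    (st : List (Buf A B)) :
    (decompressor o z h V s B).step (q, T :: st) (.inr q') =
      some (((.err, .mk []), T :: st), if q'.1 = .pop then q'.2.val else []) :=
  decompressor_step o z h V s B (v := [T]) rfl rfl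

theorem decompressor_reaches_err (l : Buf A B) (T : Buf A B) (st : List (Buf A B)) (x : List A)
    (hl : l = .mk []) :
    (decompressor o z h V s B).Reaches ((.err, l), T :: st) (x.map .inl) ((.err, .mk []), T :: st) x := by
  induction x with
  | nil => subst hl; exact .refl _
  | cons b x ih =>
    subst hl
    exact .cons (o := [b]) (decompressor_step_copy o z h V s B .err _ b T st (by simp)) ih

open Classical in
/-- After reading `w`, compressor and decompressor are synchronized: they have the same mode and
stack, and the decompressor lacks only the part of the current stack block that has been matched. -/
theorem exists_simulation (hz : z ≠ o) (w : List A) :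
    ∃ (q : Mode × Buf A B) (T : Buf A B) (st : List (Buf A B)) (x w' : List A) (l : Buf A B),
      (compressor o z h V s B).Reaches ((.copy, .mk []), [.mk []]) w (q, T :: st) x ∧
      (decompressor o z h V s B).Reaches ((.copy, .mk []), [.mk []]) (x.map .inl)
        ((q.1, l), T :: st) w' ∧
      (q.1 ≠ .pop → l = q.2) ∧
      (q.1 = .pop → T.val = [] → q.2.val = []) ∧
      (∃ st', T :: st = st' ++ [.mk []]) ∧
      w = w' ++ (if q.1 = .pop then q.2.val else []) := by
  induction w using List.reverseRecOn with
  | nil =>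
    exact ⟨(.copy, .mk []), .mk [], [], [], [], .mk [], .refl _, .refl _, fun _ => rfl,
      fun h => by simp at h, ⟨[], rfl⟩, by simp⟩
  | append_singleton w b ih =>
    obtain ⟨⟨m, lC⟩, T, st, x, w', l, hC, hD, hl, hT, ⟨st', hst⟩, hw⟩ := ih
    dsimp only at hl hT hw hD
    by_cases hm : m = .pop ∧ T.val ≠ []
    · obtain ⟨rfl, hT'⟩ := hm
      simp only [if_true] at hw
      by_cases h1 : (lC.val ++ [b]).length < T.val.length
      · refine ⟨_, T, st, x ++ [], w', l, hC.append (.single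
          (compressor_step_short o z h V s B lC b T st h1)), by simpa using hD, by simp,
          fun _ h => absurd h hT', ⟨st', hst⟩, ?_⟩
        simp only [if_true]
        rw [Buf.val_mk (h1.le.trans T.length_val), hw, List.append_assoc]
      · by_cases h2 : lC.val ++ [b] = T.val.reverse
        -- The matched block is nonempty but the bottom marker is the empty block, so something
        -- remains below.
        · have h3 : ∃ T' st'', st = T' :: st'' := by
            cases st with
            | cons T' st'' => exact ⟨_, _, rfl⟩
            | nil =>
              exfalso
              have : st' = [] ∧ T = .mk [] := by
                cases st' with
                | nil => simpa using hst
                | cons a st' => simp at hst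
              rw [this.2] at hT'
              simp at hT'
          obtain ⟨T', st'', rfl⟩ := h3
          refine ⟨_, T', st'', x ++ [o], w' ++ T.val.reverse, .mk [], hC.append (.single
            (compressor_step_match o z h V s B lC b T _ h2)), ?_, by simp, by simp, ?_, ?_⟩
          · rw [List.map_append]
            exact hD.append (.single (decompressor_step_match o z h V s B l T _ hT'))
          · cases st' with
            | nil => simp at hst
            | cons a st' => exact ⟨st', by simpa using (List.cons.inj hst).2⟩
          · simp only [if_true, Buf.val_mk_nil, List.append_nil]
            rw [← h2, hw, List.append_assoc]
        · refine ⟨_, T, st, x ++ z :: (lC.val ++ [b]), w' ++ ([] ++ (lC.val ++ [b])), .mk [],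
            hC.append (.single (compressor_step_mismatch o z h V s B lC b T _ hT' h1 h2)), ?_,
            by simp, by simp, ⟨st', hst⟩, ?_⟩
          · rw [List.map_append, List.map_cons]
            exact hD.append (.cons (decompressor_step_mismatch o z h V s B l T _ hT' hz)
              (decompressor_reaches_err o z h V s B _ T st _ rfl))
          · simp [hw]
    · have hC' := compressor_step_copy o z h V s B m lC b T st hm
      have hD' := decompressor_step_copy o z h V s B m l b T st hm
      -- The buffers of the two machines may differ in mode `pop` only, and there `copyStep` ignores
      -- the buffer.
      have hs : copyStep o h V s m l.val b T = copyStep o h V s m lC.val b T := by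
        by_cases h1 : m = .pop
        · subst h1; rfl
        · rw [hl h1]
      rw [hs] at hD'
      obtain ⟨v, hv⟩ := copyStep_stack o h V s m lC.val b T
      have hp := copyStep_pop o h V s m lC.val b T
      generalize copyStep o h V s m lC.val b T = r at hC' hD' hv hp
      obtain ⟨⟨m', l'⟩, u⟩ := r
      dsimp only at hC' hD' hv hp
      subst hv
      have h5 : ∃ T' st₁, v ++ [T] ++ st = T' :: st₁ := by
        cases v with
        | nil => exact ⟨T, st, rfl⟩
        | cons a v => exact ⟨a, _, rfl⟩
      obtain ⟨T', st₁, h5⟩ := h5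
      rw [h5] at hC' hD'
      have h6 : w = w' := by
        rw [hw]
        by_cases h1 : m = .pop
        · have : T.val = [] := by
            by_contra h2
            exact hm ⟨h1, h2⟩
          simp [hT h1 this]
        · simp [h1]
      refine ⟨_, T', st₁, x ++ [b], w' ++ [b], l', hC.append (.single hC'), ?_, by simp, ?_, ?_, ?_⟩
      · rw [List.map_append]
        exact hD.append (.single hD')
      · intro h7 _
        simp [hp h7]
      · exact ⟨v ++ st', by rw [← h5, List.append_assoc, List.append_assoc, ← hst]; rfl⟩
      · rw [h6]
        split_ifs with h7
        · simp [hp h7]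
        · simp

theorem compressor_result {w : List A} {q : Mode × Buf A B} {st : List (Buf A B)} {x : List A}
    (hw : (compressor o z h V s B).Reaches ((.copy, .mk []), [.mk []]) w (q, st) x) :
    (compressor o z h V s B).result w = some (x, q) := by
  have := (PushdownTransducer.run_eq (M := (compressor o z h V s B).toPushdownTransducer)
    (fun _ _ => rfl)).2 hw
  simp only [PushdownTransducer.result, this]
  rfl

theorem compressor_output {w : List A} {q : Mode × Buf A B} {st : List (Buf A B)} {x : List A}
    (hw : (compressor o z h V s B).Reaches ((.copy, .mk []), [.mk []]) w (q, st) x) :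
    (compressor o z h V s B).output w = x := by
  simp only [PushdownTransducer.output, compressor_result o z h V s B hw]
  rfl

theorem compressor_reaches_unique {c : (Mode × Buf A B) × List (Buf A B)} {w : List A}
    {c₁ c₂ : (Mode × Buf A B) × List (Buf A B)} {x₁ x₂ : List A}
    (h₁ : (compressor o z h V s B).Reaches c w c₁ x₁)
    (h₂ : (compressor o z h V s B).Reaches c w c₂ x₂) : c₁ = c₂ ∧ x₁ = x₂ := by
  have := Option.some.inj (Eq.trans (Eq.symm h₁) h₂)
  exact ⟨congrArg Prod.fst this, congrArg Prod.snd this⟩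

/-- Injectivity comes for free: the decompressor recovers the input from the output and the final
state. -/
theorem isInvPD (hz : z ≠ o) :
    IsInvPD (compressor o z h V s B) (decompressor o z h V s B) := by
  have key : ∀ w, ∃ x q, (compressor o z h V s B).result w = some (x, q) ∧
      ((decompressor o z h V s B).result (x.map Sum.inl ++ [Sum.inr q])).map Prod.fst =
        some w := by
    intro w
    obtain ⟨q, T, st, x, w', l, hC, hD, -, -, -, hw⟩ := exists_simulation o z h V s B hz w
    refine ⟨x, q, compressor_result o z h V s B hC, ?_⟩
    have h1 := hD.append (.single (decompressor_step_state o z h V s B _ q T st))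
    rw [← hw] at h1
    have := (PushdownTransducer.run_eq (M := (decompressor o z h V s B).toPushdownTransducer)
      (fun _ _ => rfl)).2 h1
    simp [PushdownTransducer.result, this]
  refine ⟨⟨fun w => ?_, fun w₁ w₂ h12 => ?_⟩, fun w x q hw => ?_⟩
  · obtain ⟨x, q, h1, -⟩ := key w
    simp [h1]
  · obtain ⟨x₁, q₁, h1, h1'⟩ := key w₁
    obtain ⟨x₂, q₂, h2, h2'⟩ := key w₂
    rw [h1, h2] at h12
    simp only [Option.some.injEq, Prod.mk.injEq] at h12
    obtain ⟨rfl, rfl⟩ := h12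
    exact Option.some.inj (h1'.symm.trans h2')
  · obtain ⟨x', q', h1, h1'⟩ := key w
    rw [h1] at hw
    simp only [Option.some.injEq, Prod.mk.injEq] at hw
    obtain ⟨rfl, rfl⟩ := hw
    exact h1'

end

end Palindrome

namespace Palindrome

/-! ### Words without long runs -/

/-- The word `x` does not contain `h` consecutive occurrences of `o`. -/
def NoRun {A : Type*} (o : A) (h : ℕ) (x : List A) : Prop := ¬ List.replicate h o <:+: x

section NoRun
variable {A : Type*} {o z : A} {h : ℕ}

theorem NoRun.of_infix {x y : List A} (hx : NoRun o h x) (hy : y <:+: x) : NoRun o h y :=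
  fun hr => hx (hr.trans hy)

theorem noRun_nil (hh : 0 < h) : NoRun o h ([] : List A) := by
  intro hr
  simp only [List.infix_nil, List.replicate_eq_nil_iff] at hr
  omega

/-- A run of `h` symbols `o` that ends inside `z :: v` is longer than the part of `v` read so far,
so it would have to contain `z`. -/
theorem NoRun.append_cons (hz : z ≠ o) {x v : List A} (hx : NoRun o h x) (hv : v.length < h) :
    NoRun o h (x ++ z :: v) := by
  have aux : ∀ v' : List A, v'.length < h → ¬ List.replicate h o <:+ x ++ z :: v' := by
    intro v' hv' hs
    have h1 : z :: v' <:+ List.replicate h o :=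
      List.suffix_of_suffix_length_le (List.suffix_append x (z :: v')) hs (by simpa using hv')
    exact hz (List.eq_of_mem_replicate (h1.subset (by simp)))
  induction v using List.reverseRecOn with
  | nil =>
    intro hr
    rcases List.infix_concat_iff.1 hr with hr | hr
    · exact aux [] hv hr
    · exact hx hr
  | append_singleton v b ih =>
    intro hr
    rw [← List.cons_append, ← List.append_assoc] at hr
    rcases List.infix_concat_iff.1 hr with hr | hr
    · exact aux (v ++ [b]) hv (by simpa using hr)
    · exact ih (by simp at hv; omega) hr

end NoRun

/-! ### The length of the output of the compressor -/

section
variable {A : Type*} [Fintype A] {o z : A} {h V s B : ℕ}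

theorem copyStep_switch {l : List A} {b : A} {T : Buf A B}
    (hl : List.replicate h o <:+ l ++ [b]) :
    copyStep o h V s .push l b T = ((.pop, .mk []),
        if (l ++ [b]).take ((l ++ [b]).length - h) = [] then [T]
        else [.mk ((l ++ [b]).take ((l ++ [b]).length - h)), T]) := by
  simp only [copyStep]
  rw [if_pos hl]

theorem copyStep_block {l : List A} {b : A} {T : Buf A B}
    (hl : ¬ List.replicate h o <:+ l ++ [b]) (hb : b ≠ o) (hV : V ≤ (l ++ [b]).length) :
    copyStep o h V s .push l b T = ((.push, .mk []), [.mk (l ++ [b]), T]) := by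
  simp only [copyStep]
  rw [if_neg hl, if_pos ⟨hb, hV⟩]

theorem copyStep_append {l : List A} {b : A} {T : Buf A B}
    (hl : ¬ List.replicate h o <:+ l ++ [b]) (hb : b ≠ o → (l ++ [b]).length < V) :
    copyStep o h V s .push l b T = ((.push, .mk (l ++ [b])), [T]) := by
  simp only [copyStep]
  rw [if_neg hl, if_neg fun h => absurd (hb h.1) (by omega)]

theorem reaches_start (hs : s ≤ B) {st : List (Buf A B)} {T : Buf A B} (p q : List A)
    (hpq : (p ++ q).length = s) (hq : q ≠ []) :
    (compressor o z h V s B).Reaches ((.copy, .mk p), T :: st) q ((.pop, .mk []), T :: st) q := by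
  induction q generalizing p with
  | nil => exact absurd rfl hq
  | cons b q ih =>
    have h1 := compressor_step_copy o z h V s B .copy (.mk p) b T st (by simp)
    have hp : (Buf.mk p : Buf A B).val = p := Buf.val_mk (by simp at hpq; omega)
    rw [hp] at h1
    simp only [copyStep] at h1
    by_cases hq' : q = []
    · subst hq'
      rw [if_neg (by rw [hpq]; omega)] at h1
      exact .single h1
    · have hlen : (p ++ [b]).length < s := by
        have := List.length_pos_iff.2 hq'
        simp at hpq ⊢
        omega
      rw [if_pos hlen] at h1
      exact .cons (o := [b]) h1 (ih (p ++ [b]) (by simpa using hpq) hq')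

/-- A block is closed only at a symbol other than `o`, so a run is never split between a block and
the buffer. The buffer is a part `l` shorter than `V` followed by `j < h` symbols `o`, which is why
capacity `V + h` suffices. Every block has length at least `V`, whence the bound on their number. -/
theorem reaches_push (hh : 0 < h) (hB : V + h ≤ B) (hV : 0 < V) {st : List (Buf A B)}
    (hst : st ≠ []) {x : List A} (hx : NoRun o h x) :
    ∃ (bs : List (Buf A B)) (l : List A) (j : ℕ),
      (compressor o z h V s B).Reaches ((.push, .mk []), st) x ((.push, .mk (l ++ .replicate j o)),
        bs ++ st) x ∧
      (bs.reverse.map Buf.val).flatten ++ (l ++ .replicate j o) = x ∧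
      (∀ T ∈ bs, T.val ≠ []) ∧ V * bs.length + l.length + j ≤ x.length ∧ l.length < V ∧
      j < h := by
  induction x using List.reverseRecOn with
  | nil => exact ⟨[], [], 0, .refl _, by simp, by simp, by simp, hV, hh⟩
  | append_singleton x b ih =>
    obtain ⟨bs, l, j, h1, h2, h3, h4, h5, h6⟩ := ih (hx.of_infix (List.infix_append [] x [b]))
    have hl : ¬ List.replicate h o <:+ (l ++ .replicate j o) ++ [b] := by
      intro hr
      apply hx
      rw [← h2, List.append_assoc]
      exact (hr.trans (List.suffix_append _ _)).isInfix
    obtain ⟨T, st', hT⟩ : ∃ T st', bs ++ st = T :: st' := List.exists_cons_of_ne_nil (by simp [hst])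
    rw [hT] at h1
    have hval : (Buf.mk (l ++ .replicate j o) : Buf A B).val = l ++ .replicate j o :=
      Buf.val_mk (by simp; omega)
    have h7 := compressor_step_copy o z h V s B .push (.mk (l ++ .replicate j o)) b T st' (by simp)
    rw [hval] at h7
    by_cases hb : b = o
    · subst hb
      rw [copyStep_append hl (by simp)] at h7
      have h8 : l ++ .replicate j b ++ [b] = l ++ .replicate (j + 1) b := by
        rw [List.append_assoc, List.replicate_succ']
      rw [h8] at h7 hl
      refine ⟨bs, l, j + 1, ?_, ?_, h3, by simp; omega, h5, ?_⟩
      · rw [hT]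
        exact h1.append (.single h7)
      · rw [← h8, ← List.append_assoc, h2]
      · rcases Nat.lt_or_ge (j + 1) h with h9 | h9
        · exact h9
        · have : j + 1 = h := by omega
          rw [this] at hl
          exact absurd (List.suffix_append _ _) hl
    · by_cases hlen : V ≤ (l ++ .replicate j o ++ [b]).length
      · rw [copyStep_block hl hb hlen] at h7
        have hval' : (Buf.mk (l ++ .replicate j o ++ [b]) : Buf A B).val =
            l ++ .replicate j o ++ [b] := Buf.val_mk (by simp; omega)
        refine ⟨.mk (l ++ .replicate j o ++ [b]) :: bs, [], 0, ?_, ?_, ?_, ?_, hV, hh⟩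
        · rw [List.cons_append, hT]
          exact h1.append (.single h7)
        · simp only [List.reverse_cons, List.map_append, List.map_cons, List.map_nil,
            List.flatten_append, hval']
          rw [← h2]
          simp
        · intro T' hT'
          rcases List.mem_cons.1 hT' with rfl | hT'
          · rw [hval']; simp
          · exact h3 T' hT'
        · simp only [List.length_append, List.length_replicate, List.length_cons, List.length_nil,
            Nat.mul_add] at hlen ⊢
          omega
      · rw [copyStep_append hl (fun _ => by omega)] at h7
        refine ⟨bs, l ++ .replicate j o ++ [b], 0, ?_, ?_, h3, ?_, by omega, hh⟩
        · rw [hT, List.replicate_zero, List.append_nil]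
          exact h1.append (.single h7)
        · rw [← h2]; simp
        · simp; omega

/-- As long as the run has fewer than `h` symbols it just accumulates in the buffer, because blocks
do not end with `o`. -/
theorem reaches_run (hB : V + h ≤ B) {st : List (Buf A B)} (hst : st ≠ [])
    {l : List A} {j : ℕ} (i : ℕ) (hl : l.length < V) (hj : j + i < h)
    (hr : NoRun o h (l ++ .replicate j o ++ .replicate i o)) :
    (compressor o z h V s B).Reaches ((.push, .mk (l ++ .replicate j o)), st) (.replicate i o)
      ((.push, .mk (l ++ .replicate j o ++ .replicate i o)), st) (.replicate i o) := by
  obtain ⟨T, st', rfl⟩ := List.exists_cons_of_ne_nil hst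
  induction i with
  | zero => simpa using PushdownTransducer.Reaches.refl _
  | succ i ih =>
    rw [List.replicate_succ', ← List.append_assoc] at hr ⊢
    refine (ih (by omega) (hr.of_infix (List.prefix_append _ _).isInfix)).append (.single ?_)
    have h7 := compressor_step_copy o z h V s B .push
      (.mk (l ++ .replicate j o ++ .replicate i o)) o T st' (by simp)
    rw [Buf.val_mk (by simp; omega), copyStep_append (fun h => hr h.isInfix) (by simp)] at h7
    exact h7

theorem reaches_block {p q : List A} {T : Buf A B} {st : List (Buf A B)}
    (hpq : p ++ q = T.val.reverse) (hq : q ≠ []) :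
    (compressor o z h V s B).Reaches ((.pop, .mk p), T :: st) q ((.pop, .mk []), st) [o] := by
  have hlen := congrArg List.length hpq
  have hTB := T.length_val
  simp only [List.length_append, List.length_reverse] at hlen
  induction q generalizing p with
  | nil => exact absurd rfl hq
  | cons b q ih =>
    have hp : (Buf.mk p : Buf A B).val = p := Buf.val_mk (by omega)
    by_cases hq' : q = []
    · subst hq'
      exact .single (compressor_step_match o z h V s B (.mk p) b T st (by rw [hp, hpq]))
    · have := List.length_pos_iff.2 hq'
      have h1 := compressor_step_short o z h V s B (.mk p) b T st (by
        rw [hp]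
        simp only [List.length_append, List.length_cons, List.length_nil] at hlen ⊢
        omega)
      rw [hp] at h1
      refine .cons (o := []) h1 (ih (by simpa using hpq) hq' ?_)
      simp only [List.length_append, List.length_cons, List.length_nil] at hlen ⊢
      omega

theorem reaches_blocks {bs st : List (Buf A B)} (hbs : ∀ T ∈ bs, T.val ≠ []) :
    (compressor o z h V s B).Reaches ((.pop, .mk []), bs ++ st)
      (bs.map fun T => T.val.reverse).flatten ((.pop, .mk []), st) (.replicate bs.length o) := by
  induction bs with
  | nil => exact .refl _
  | cons T bs ih =>
    simp only [List.map_cons, List.flatten_cons, List.length_cons]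
    rw [List.replicate_succ]
    refine (reaches_block (o := o) (z := z) (h := h) (V := V) (s := s) (p := [])
      (q := T.val.reverse) (by simp) ?_).append (ih fun T' h => hbs T' (by simp [h]))
    simpa using hbs T (by simp)

/-- The compressor shortens `o u z o^h z u⁻¹` to about `|u| + |u| / V` symbols. -/
theorem reaches_palindrome (hz : z ≠ o) (hh : 0 < h) (hB : V + h ≤ B) (hV : 0 < V)
    {u : List A} (hu : NoRun o h u) :
    ∃ (x : List A) (n : ℕ),
      (compressor o z h V s B).Reaches ((.pop, .mk []), [.mk []])
        (o :: u ++ (z :: .replicate h o ++ z :: u.reverse)) ((.pop, .mk []), [.mk []]) x ∧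
      V * n ≤ u.length + 1 ∧ x.length ≤ u.length + h + 3 + n := by
  have hu' : NoRun o h (u ++ [z]) := hu.append_cons hz hh
  obtain ⟨bs, l, j, h1, h2, h3, h4, h5, h6⟩ :=
    reaches_push (z := z) (s := s) hh hB hV (st := [.mk []]) (by simp) hu'
  -- The word that was read ends with `z`, not with `o`.
  have hj : j = 0 := by
    cases j with
    | zero => rfl
    | succ j =>
      rw [List.replicate_succ', ← List.append_assoc, ← List.append_assoc] at h2
      exact absurd (List.append_inj_right' h2 rfl) (by simpa using hz.symm)
  subst hj
  have h0 := compressor_step_copy o z h V s B .pop (.mk []) o (.mk []) [] (by simp)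
  -- Only `h - 1` symbols of the run are read here; the last one triggers the switch to mode `pop`
  -- and is treated separately.
  have hr : NoRun o h (l ++ .replicate 0 o ++ .replicate (h - 1) o) := by
    refine (hu.append_cons hz (v := .replicate (h - 1) o) (by simp; omega)).of_infix ?_
    have : u ++ z :: .replicate (h - 1) o = (u ++ [z]) ++ .replicate (h - 1) o := by simp
    rw [this, ← h2, List.append_assoc _ (l ++ _)]
    exact (List.suffix_append _ _).isInfix
  have h8 := reaches_run (z := z) (s := s) hB (st := bs ++ [.mk []]) (by simp) (h - 1) h5
    (by omega) hr
  simp only [List.replicate_zero, List.append_nil] at h1 h2 h8 hr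
  obtain ⟨T, st', hT⟩ : ∃ T st', bs ++ [Buf.mk []] = T :: st' :=
    List.exists_cons_of_ne_nil (by simp)
  have hrep : l ++ .replicate (h - 1) o ++ [o] = l ++ .replicate h o := by
    obtain ⟨h, rfl⟩ : ∃ h', h = h' + 1 := ⟨h - 1, by omega⟩
    rw [Nat.add_sub_cancel, List.replicate_succ', List.append_assoc]
  have h9 := compressor_step_copy o z h V s B .push (.mk (l ++ .replicate (h - 1) o)) o T st'
    (by simp)
  rw [Buf.val_mk (by simp; omega), copyStep_switch (by rw [hrep]; exact List.suffix_append _ _),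
    hrep] at h9
  have htake : (l ++ .replicate h o).take ((l ++ List.replicate h o).length - h) = l := by simp
  rw [htake] at h9
  obtain ⟨bs', h10, h11, h12, h13⟩ : ∃ bs' : List (Buf A B),
      (compressor o z h V s B).step ((.push, .mk (l ++ .replicate (h - 1) o)), T :: st') o =
        some (((.pop, .mk []), bs' ++ [.mk []]), [o]) ∧
      (bs'.reverse.map Buf.val).flatten = u ++ [z] ∧ (∀ T ∈ bs', T.val ≠ []) ∧
      bs'.length ≤ bs.length + 1 := by
    -- What precedes the run in the buffer becomes a last, possibly short block; if it is empty, no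
    -- block is pushed, since an empty block would look like the bottom of the stack.
    by_cases hl : l = []
    · subst hl
      rw [if_pos rfl] at h9
      refine ⟨bs, h9.trans (congrArg (fun y : List (Buf A B) =>
        some (((Mode.pop, (Buf.mk [] : Buf A B)), y), [o])) hT.symm), by simpa using h2, h3, by omega⟩
    · rw [if_neg hl] at h9
      have hval : (Buf.mk l : Buf A B).val = l := Buf.val_mk (by omega)
      refine ⟨.mk l :: bs, h9.trans (congrArg (fun y : List (Buf A B) =>
        some (((Mode.pop, (Buf.mk [] : Buf A B)), Buf.mk l :: y), [o])) hT.symm), ?_, ?_, by simp⟩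
      · rw [← h2]
        simp [hval]
      · intro T hT
        rcases List.mem_cons.1 hT with rfl | hT
        · rwa [hval]
        · exact h3 T hT
  have h14 := reaches_blocks (o := o) (z := z) (h := h) (V := V) (s := s) (st := [.mk []]) h12
  have h15 : (bs'.map fun T => T.val.reverse).flatten = z :: u.reverse := by
    have := congrArg List.reverse h11
    rw [List.reverse_flatten] at this
    simpa [Function.comp_def] using this
  rw [h15] at h14
  have h10' := (congrArg (fun y : List (Buf A B) => (compressor o z h V s B).step
    ((.push, .mk (l ++ .replicate (h - 1) o)), y) o) hT).trans h10
  have h16 := PushdownTransducer.Reaches.cons (o := [o]) h0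
    (h1.append (h8.append (.cons (o := [o]) h10' h14)))
  have h17 : o :: (u ++ [z] ++ (.replicate (h - 1) o ++ o :: z :: u.reverse)) =
      o :: u ++ (z :: .replicate h o ++ z :: u.reverse) := by
    obtain ⟨h, rfl⟩ : ∃ h', h = h' + 1 := ⟨h - 1, by omega⟩
    simp [List.replicate_succ']
  rw [h17] at h16
  refine ⟨_, bs.length, h16, le_trans (by omega) (h4.trans (by simp)), ?_⟩
  simp
  omega

/-- The worst case is a mismatch: the marker, a full buffer and the current symbol. -/
theorem compressor_length_out_le (q : Mode × Buf A B) (b : A) (T : Buf A B) :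
    ((compressor o z h V s B).out q b T).length ≤ B + 2 := by
  have := q.2.length_val
  simp only [compressor]
  split_ifs <;> simp
  omega

/-- The length of the output on a prefix of a sequence of palindromes. -/
theorem length_compressor_output_le (hz : z ≠ o) (hh : 0 < h) (hB : V + h ≤ B) (hV : 0 < V)
    (hs : s ≤ B) {p : List A} (hp : p.length = s) (hp' : p ≠ []) {us : List (List A)}
    (hus : ∀ u ∈ us, NoRun o h u) (t : List A) :
    ((compressor o z h V s B).output
      (p ++ (us.map fun u => o :: u ++ (z :: .replicate h o ++ z :: u.reverse)).flatten ++
        t)).length ≤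
      s + (us.map fun u => u.length + h + 3 + (u.length + 1) / V).sum + (B + 2) * t.length := by
  have h1 := reaches_start (o := o) (z := z) (h := h) (V := V) hs (st := []) (T := .mk []) [] p
    (by simpa using hp) hp'
  have h2 : ∃ x, (compressor o z h V s B).Reaches ((.pop, .mk []), [.mk []])
      (us.map fun u => o :: u ++ (z :: .replicate h o ++ z :: u.reverse)).flatten
      ((.pop, .mk []), [.mk []]) x ∧
      x.length ≤ (us.map fun u => u.length + h + 3 + (u.length + 1) / V).sum := by
    induction us with
    | nil => exact ⟨[], .refl _, by simp⟩
    | cons u us ih =>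
      obtain ⟨x, hx, hx'⟩ := ih fun u hu => hus u (by simp [hu])
      obtain ⟨y, n, hy, hn, hy'⟩ := reaches_palindrome (s := s) hz hh hB hV (hus u (by simp))
      refine ⟨y ++ x, hy.append hx, ?_⟩
      have : n ≤ (u.length + 1) / V := (Nat.le_div_iff_mul_le hV).2 (by linarith)
      simp only [List.length_append, List.map_cons, List.sum_cons]
      omega
  obtain ⟨x, hx, hx'⟩ := h2
  -- The compressor never gets stuck on the whole word, and by determinism its run passes through
  -- the configuration reached before `t`.
  have h3 : ∃ c y, (compressor o z h V s B).Reaches ((.pop, .mk []), [.mk []]) t c y := by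
    obtain ⟨q, T, st, y, -, -, hC, -⟩ := exists_simulation o z h V s B hz
      (p ++ (us.map fun u => o :: u ++ (z :: .replicate h o ++ z :: u.reverse)).flatten ++ t)
    obtain ⟨c', x₁, x₂, h5, h6, -⟩ := hC.exists_of_append
    obtain ⟨rfl, -⟩ := compressor_reaches_unique o z h V s B (h1.append hx) h5
    exact ⟨_, _, h6⟩
  obtain ⟨⟨q, st⟩, y, hy⟩ := h3
  have h4 := (h1.append hx).append hy
  rw [compressor_output o z h V s B h4]
  have := hy.length_le compressor_length_out_le
  have h5 : p.length = s := hp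
  simp only [List.length_append]
  omega

end
end Palindrome

/-! ### A lower bound for the output of LZ -/

section LempelZiv
variable {A : Type*}

/-- A list of distinct nonempty words in which each word extends by one symbol the empty word or an
earlier word. -/
inductive IsLZParsing : List (List A) → Prop
  | nil : IsLZParsing []
  | snoc {ps : List (List A)} {p : List A} : IsLZParsing ps → p ≠ [] → p ∉ ps →
    (p.dropLast = [] ∨ p.dropLast ∈ ps) → IsLZParsing (ps ++ [p])

theorem IsLZParsing.mem_of_prefix {ps : List (List A)} (hps : IsLZParsing ps) {p q : List A}
    (hp : p ∈ ps) (hq : q <+: p) (hq' : q ≠ []) : q ∈ ps := by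
  induction hps generalizing p with
  | nil => simp at hp
  | @snoc ps p' _ h1 h2 h3 ih =>
    rcases List.mem_append.1 hp with hp | hp
    · exact List.mem_append_left _ (ih hp hq)
    · obtain rfl := List.mem_singleton.1 hp
      rcases List.prefix_concat_iff.1 ((List.dropLast_concat_getLast h1).symm ▸ hq) with h4 | h4
      · rw [h4, List.dropLast_concat_getLast]
        simp
      · rcases h3 with h3 | h3
        · rw [h3, List.prefix_nil] at h4
          exact absurd h4 hq'
        · exact List.mem_append_left _ (ih h3 h4)

theorem IsLZParsing.nodup {ps : List (List A)} (hps : IsLZParsing ps) : ps.Nodup := by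
  induction hps with
  | nil => exact List.nodup_nil
  | snoc _ h1 h2 h3 ih => exact List.nodup_append_comm.1 (List.nodup_cons.2 ⟨h2, ih⟩)

theorem IsLZParsing.dropLast_mem {ps : List (List A)} (hps : IsLZParsing ps) {p : List A}
    (hp : p ∈ ps) : p ≠ [] ∧ p.dropLast ∈ [] :: ps := by
  induction hps with
  | nil => simp at hp
  | snoc _ h1 h2 h3 ih =>
    rcases List.mem_append.1 hp with hp | hp
    · obtain ⟨h4, h5⟩ := ih hp
      refine ⟨h4, ?_⟩
      rw [← List.cons_append]
      exact List.mem_append_left _ h5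
    · obtain rfl := List.mem_singleton.1 hp
      refine ⟨h1, ?_⟩
      rcases h3 with h3 | h3 <;> simp [h3]

/-- The parser keeps reading while it sees old phrases, and `cur ++ p` is the first word it meets
that is not in the dictionary. -/
theorem lzPhrasesAux_append [DecidableEq A] {d : List (List A)} {cur p w : List A} (hp : p ≠ [])
    (hd : cur ++ p ∉ d) (hpre : ∀ q, q <+: cur ++ p → q ≠ [] → q ≠ cur ++ p → q ∈ d) :
    lzPhrasesAux d cur (p ++ w) = (cur ++ p) :: lzPhrasesAux (d ++ [cur ++ p]) [] w := by
  induction p generalizing cur with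
  | nil => exact absurd rfl hp
  | cons b p ih =>
    rw [List.cons_append, lzPhrasesAux]
    by_cases hp' : p = []
    · subst hp'
      rw [if_neg hd]
      rfl
    · have h1 : cur ++ b :: p = cur ++ [b] ++ p := by simp
      rw [h1] at hd hpre ⊢
      rw [if_pos (hpre _ (List.prefix_append _ _) (by simp) (by simpa using hp'))]
      exact ih hp' hd hpre

/-- The greedy parsing is forced: exhibiting a list with the properties of `IsLZParsing` determines
how its concatenation is parsed, whatever follows. -/
theorem IsLZParsing.lzPhrases_append [DecidableEq A] {ps : List (List A)} (hps : IsLZParsing ps) (w : List A) :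
    lzPhrases (ps.flatten ++ w) = ps ++ lzPhrasesAux ps [] w := by
  unfold lzPhrases
  induction hps generalizing w with
  | nil => rfl
  | @snoc ps p hps h1 h2 h3 ih =>
    rw [List.flatten_append, List.flatten_singleton, List.append_assoc, ih,
      lzPhrasesAux_append h1 (by simpa using h2), List.append_assoc]
    · rfl
    · intro q hq hq' hne
      have := (hps.snoc h1 h2 h3).mem_of_prefix (p := p) (by simp) hq hq'
      simpa [show q ≠ p from hne] using this

/-- The geometric sum `1 + k + ... + k^(L-1)` is less than `k^L` for `k ≥ 2`. -/
theorem card_filter_length_lt [Fintype A] [Nontrivial A] (F : Finset (List A)) (L : ℕ) :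
    (F.filter fun w => w.length < L).card ≤ Fintype.card A ^ L := by
  classical
  have h1 : (F.filter fun w => w.length < L) ⊆
      (Finset.univ : Finset (Σ j : Fin L, Fin j → A)).image fun x => List.ofFn x.2 := by
    intro w hw
    rw [Finset.mem_filter] at hw
    exact Finset.mem_image.2 ⟨⟨⟨w.length, hw.2⟩, w.get⟩, Finset.mem_univ _, List.ofFn_get w⟩
  refine (Finset.card_le_card h1).trans (Finset.card_image_le.trans ?_)
  rw [Finset.card_univ, Fintype.card_sigma]
  simp only [Fintype.card_pi, Finset.prod_const, Finset.card_univ, Fintype.card_fin]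
  rw [Fin.sum_univ_eq_sum_range fun i => Fintype.card A ^ i]
  exact (Nat.geomSum_lt Fintype.one_lt_card fun i hi => Finset.mem_range.1 hi).le

/-- The total length of distinct words. -/
theorem le_sum_length [Fintype A] [Nontrivial A] (F : Finset (List A)) (L : ℕ) :
    (F.card - Fintype.card A ^ L) * L ≤ ∑ w ∈ F, w.length := by
  have h1 := card_filter_length_lt F L
  have h2 := Finset.card_filter_add_card_filter_not (s := F) (fun w => w.length < L)
  calc (F.card - Fintype.card A ^ L) * L ≤ (F.filter fun w => ¬ w.length < L).card * L :=
        Nat.mul_le_mul_right _ (by omega)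
    _ = ∑ w ∈ F.filter fun w => ¬ w.length < L, L := by simp
    _ ≤ ∑ w ∈ F.filter fun w => ¬ w.length < L, w.length :=
        Finset.sum_le_sum fun w hw => by simpa using (Finset.mem_filter.1 hw).2
    _ ≤ ∑ w ∈ F, w.length :=
        Finset.sum_le_sum_of_subset (Finset.filter_subset _ _)

/-- A phrase is determined by its parent and its last symbol, so the words written for the phrases
in `ps` are distinct and `le_sum_length` applies. Of the code only injectivity is needed. The
remaining phrases `r`, among them a possible repeated last phrase, can only add to the length. -/
theorem IsLZParsing.le_length_lzOutput [DecidableEq A] [Fintype A] [Nontrivial A] {ps : List (List A)}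
    (hps : IsLZParsing ps) {code : ℕ → List A} (hc : Function.Injective code) (L : ℕ)
    (w : List A) :
    (ps.length - Fintype.card A ^ L) * L ≤ (lzOutput code (ps.flatten ++ w)).length := by
  unfold lzOutput
  rw [hps.lzPhrases_append]
  generalize lzPhrasesAux ps [] w = r
  rw [List.flatMap_append, List.length_append, List.length_flatMap]
  set f : List A → List A := fun p =>
    code (([] :: (ps ++ r)).idxOf p.dropLast) ++ p.getLast?.toList with hf
  have hinj : Set.InjOn f (ps.toFinset : Set (List A)) := by
    intro p hp q hq hpq
    rw [Finset.mem_coe, List.mem_toFinset] at hp hq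
    obtain ⟨hp1, hp2⟩ := hps.dropLast_mem hp
    obtain ⟨hq1, hq2⟩ := hps.dropLast_mem hq
    simp only [hf, List.getLast?_eq_some_getLast hp1, List.getLast?_eq_some_getLast hq1,
      Option.toList_some] at hpq
    obtain ⟨h1, h2⟩ := List.append_inj' hpq rfl
    -- The parent does occur in the list, so its index is not the default value of `idxOf`.
    have h3 := (List.idxOf_inj (by
      rw [← List.cons_append]; exact List.mem_append_left _ hp2)).1 (hc h1)
    rw [← List.dropLast_concat_getLast hp1, ← List.dropLast_concat_getLast hq1, h3, h2]
  have h1 := le_sum_length (ps.toFinset.image f) L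
  rw [Finset.card_image_of_injOn hinj, Finset.sum_image hinj,
    List.toFinset_card_of_nodup hps.nodup,
    List.sum_toFinset (fun p => (f p).length) hps.nodup] at h1
  exact h1.trans (Nat.le_add_right _ _)

end LempelZiv

/-! ### Sequences -/

theorem seqPrefix_succ {α : Type*} (f : ℕ → α) (n : ℕ) :
    seqPrefix f (n + 1) = seqPrefix f n ++ [f n] := by
  simp [seqPrefix, List.range_succ]

theorem length_seqPrefix {α : Type*} (f : ℕ → α) (n : ℕ) : (seqPrefix f n).length = n := by
  simp [seqPrefix]

theorem mem_seqPrefix {α : Type*} {f : ℕ → α} {n : ℕ} {a : α} :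
    a ∈ seqPrefix f n ↔ ∃ i < n, f i = a := by
  simp [seqPrefix]

theorem sum_map_seqPrefix {α : Type*} (f : ℕ → α) (g : α → ℕ) (n : ℕ) :
    ((seqPrefix f n).map g).sum = ∑ i ∈ Finset.range n, g (f i) := by
  induction n with
  | zero => rfl
  | succ n ih => simp [seqPrefix_succ, ih, Finset.sum_range_succ]

theorem seqPrefix_prefix {α : Type*} (f : ℕ → α) {m n : ℕ} (h : m ≤ n) :
    seqPrefix f m <+: seqPrefix f n := by
  induction n, h using Nat.le_induction with
  | base => exact List.prefix_rfl
  | succ n _ ih => exact ih.trans (seqPrefix_succ f n ▸ List.prefix_append _ _)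

/-- A chain of longer and longer words has a limit. -/
theorem exists_seqPrefix_eq {α : Type*} (X : ℕ → List α) (hX : ∀ n, X n <+: X (n + 1))
    (hlen : ∀ n, n ≤ (X n).length) : ∃ f : ℕ → α, ∀ n, seqPrefix f (X n).length = X n := by
  have hmono : ∀ m n, m ≤ n → X m <+: X n := by
    intro m n h
    induction n, h using Nat.le_induction with
    | base => exact List.prefix_rfl
    | succ n _ ih => exact ih.trans (hX n)
  have hlt : ∀ n, n < (X (n + 1)).length := fun n => hlen (n + 1)
  refine ⟨fun i => (X (i + 1))[i]'(hlt i), fun n => ?_⟩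
  apply List.ext_getElem
  · rw [length_seqPrefix]
  · intro i h1 h2
    simp only [seqPrefix, List.getElem_map, List.getElem_range]
    rcases le_total (i + 1) n with h | h
    · exact (hmono _ _ h).getElem (hlt i)
    · exact ((hmono _ _ h).getElem h2).symm

/-! ### Enumeration of words by length -/

section
variable {A : Type*} [Fintype A] [Nontrivial A]

/-- With `k` symbols, add `k^n` to the base-`k` value of a word of length `n`. The ranks of these
words lie in `[k^n, 2k^n)`, and these intervals are disjoint since `k ≥ 2`. -/
theorem exists_rank : ∃ e : List A → ℕ, Function.Injective e ∧
    ∀ v w, e v ≤ e w → v.length ≤ w.length := by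
  set k := Fintype.card A with hk
  have hk1 : 1 < k := Fintype.one_lt_card
  let d : A → ℕ := fun a => (Fintype.equivFin A a : ℕ)
  have hd : ∀ w : List A, ∀ l ∈ w.map d, l < k := by
    intro w l hl
    obtain ⟨a, -, rfl⟩ := List.mem_map.1 hl
    exact (Fintype.equivFin A a).2
  have hdi : Function.Injective d := fun a b h =>
    (Fintype.equivFin A).injective (Fin.ext h)
  have hlt : ∀ w : List A, Nat.ofDigits k (w.map d) < k ^ w.length := fun w => by
    simpa using Nat.ofDigits_lt_base_pow_length hk1 (hd w)
  have hmono : ∀ v w : List A, k ^ v.length + Nat.ofDigits k (v.map d) ≤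
      k ^ w.length + Nat.ofDigits k (w.map d) → v.length ≤ w.length := by
    intro v w h
    by_contra! hvw
    have h1 : k ^ (w.length + 1) ≤ k ^ v.length := Nat.pow_le_pow_right (by omega) hvw
    have h2 := hlt w
    have h3 : k ^ w.length * 2 ≤ k ^ w.length * k := Nat.mul_le_mul_left _ hk1
    rw [pow_succ] at h1
    omega
  refine ⟨fun w => k ^ w.length + Nat.ofDigits k (w.map d), fun v w h => ?_, hmono⟩
  have hl := le_antisymm (hmono v w h.le) (hmono w v h.ge)
  simp only [hl, Nat.add_left_cancel_iff] at h
  exact List.map_injective_iff.2 hdi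
    (Nat.ofDigits_inj_of_len_eq hk1 (by simpa using hl) (hd v) (hd w) h)

/-- An infinite set of words can be enumerated in the order of their lengths. -/
theorem exists_enumeration {P : Set (List A)} (hP : P.Infinite) :
    ∃ u : ℕ → List A, Function.Injective u ∧ Set.range u = P ∧ Monotone fun i => (u i).length := by
  obtain ⟨e, he, hmono⟩ := exists_rank (A := A)
  have hinf : Infinite (e '' P) := (hP.image he.injOn).to_subtype
  classical
  let φ := Nat.Subtype.orderIsoOfNat (e '' P)
  have hex : ∀ i, ∃ w, w ∈ P ∧ e w = φ i := fun i => (φ i).2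
  choose u hu hφ using hex
  refine ⟨u, fun i j h => ?_, ?_, fun i j h => ?_⟩
  · apply φ.injective
    apply Subtype.ext
    rw [← hφ, ← hφ, h]
  · ext w
    constructor
    · rintro ⟨i, rfl⟩
      exact hu i
    · intro hw
      obtain ⟨i, hi⟩ := φ.surjective ⟨e w, w, hw, rfl⟩
      refine ⟨i, he ?_⟩
      rw [hφ, hi]
  · apply hmono
    rw [hφ, hφ]
    exact_mod_cast φ.monotone h

end

/-! ### Counting and enumerating the words without long runs -/

namespace Palindrome

section
variable {A : Type*} {o z : A} {h : ℕ}

theorem noRun_replicate (hz : z ≠ o) (hh : 0 < h) (n : ℕ) : NoRun o h (List.replicate n z) := by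
  induction n with
  | zero => exact noRun_nil hh
  | succ n ih =>
    rw [List.replicate_succ']
    exact ih.append_cons hz hh

/-- The number of words of length `h * q` without long runs. -/
theorem exists_noRun_finset [Fintype A] (hz : z ≠ o) (hh : 0 < h) (q : ℕ) :
    ∃ F : Finset (List A), (∀ w ∈ F, NoRun o h w ∧ w.length = h * q) ∧
      Fintype.card A ^ ((h - 1) * q) ≤ F.card := by
  classical
  induction q with
  | zero => exact ⟨{[]}, by simpa using noRun_nil hh, by simp⟩
  | succ q ih =>
    obtain ⟨F, hF, hc⟩ := ih
    -- Append a block `z v` with `v` an arbitrary word of length `h - 1`: only one symbol in `h` is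
    -- prescribed.
    refine ⟨(F ×ˢ (Finset.univ : Finset (List.Vector A (h - 1)))).image
      fun x => x.1 ++ z :: x.2.1, ?_, ?_⟩
    · intro w hw
      obtain ⟨⟨w, v⟩, h1, rfl⟩ := Finset.mem_image.1 hw
      obtain ⟨h2, h3⟩ := hF w (Finset.mem_product.1 h1).1
      have h4 := v.2
      refine ⟨h2.append_cons hz (h4.trans_lt (by omega)), ?_⟩
      have h5 : (v.1).length = h - 1 := h4
      simp only [List.length_append, List.length_cons, h3, h5, Nat.mul_add]
      omega
    · rw [Finset.card_image_of_injOn, Finset.card_product, Finset.card_univ, card_vector,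
        Nat.mul_add, mul_one, pow_add]
      · exact Nat.mul_le_mul_right _ hc
      · rintro ⟨w, v⟩ - ⟨w', v'⟩ - h1
        obtain ⟨h2, h3⟩ := List.append_inj' h1 (by simp)
        exact Prod.ext h2 (Subtype.ext (List.cons.inj h3).2)

/-- An enumeration of the words without long runs. -/
structure IsEnumeration (o : A) (h : ℕ) (u : ℕ → List A) : Prop where
  injective : Function.Injective u
  range_eq : Set.range u = {w | NoRun o h w}
  monotone : Monotone fun i => (u i).length

theorem exists_isEnumeration [Fintype A] [Nontrivial A] (hz : z ≠ o) (hh : 0 < h) : ∃ u, IsEnumeration o h u := by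
  have hinf : {w : List A | NoRun o h w}.Infinite :=
    Set.infinite_of_injective_forall_mem (f := fun n => List.replicate n z)
      (fun m n hmn => by simpa using congrArg List.length hmn) (noRun_replicate hz hh)
  obtain ⟨u, h1, h2, h3⟩ := exists_enumeration hinf
  exact ⟨u, h1, h2, h3⟩

namespace IsEnumeration
variable {u : ℕ → List A}

theorem noRun (hu : IsEnumeration o h u) (i : ℕ) : NoRun o h (u i) := by
  have : u i ∈ Set.range u := ⟨i, rfl⟩
  rwa [hu.range_eq] at this

theorem exists_lt (hu : IsEnumeration o h u) {i : ℕ} {w : List A} (hw : NoRun o h w) (hlen : w.length < (u i).length) :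
    ∃ j < i, u j = w := by
  have : w ∈ Set.range u := by rwa [hu.range_eq]
  obtain ⟨j, rfl⟩ := this
  refine ⟨j, ?_, rfl⟩
  by_contra! hij
  exact absurd (hu.monotone hij) (by simpa using hlen)

theorem card_le (hu : IsEnumeration o h u) {i : ℕ} {F : Finset (List A)}
    (hF : ∀ w ∈ F, NoRun o h w ∧ w.length < (u i).length) : F.card ≤ i := by
  classical
  have : F ⊆ (Finset.range i).image u := by
    intro w hw
    obtain ⟨j, hj, rfl⟩ := hu.exists_lt (hF w hw).1 (hF w hw).2
    exact Finset.mem_image_of_mem _ (Finset.mem_range.2 hj)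
  simpa using (Finset.card_le_card this).trans Finset.card_image_le

/-- The shorter words `z^n` all come earlier. This crude bound is enough to control the incomplete
last palindrome. -/
theorem length_le (hu : IsEnumeration o h u) (hz : z ≠ o) (hh : 0 < h) (i : ℕ) : (u i).length ≤ i := by
  classical
  have := hu.card_le (i := i) (F := (Finset.range (u i).length).image fun n => List.replicate n z)
    (by
      intro w hw
      obtain ⟨n, hn, rfl⟩ := Finset.mem_image.1 hw
      exact ⟨noRun_replicate hz hh n, by simpa using hn⟩)
  rwa [Finset.card_image_of_injective _ fun m n hmn => by simpa using congrArg List.length hmn,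
    Finset.card_range] at this

/-- All words of length `h * q` without long runs precede `u i`. -/
theorem pow_le [Fintype A] (hu : IsEnumeration o h u) (hz : z ≠ o) (hh : 0 < h) {i q : ℕ} (hq : h * q < (u i).length) :
    Fintype.card A ^ ((h - 1) * q) ≤ i := by
  obtain ⟨F, hF, hc⟩ := exists_noRun_finset hz hh q
  exact hc.trans (hu.card_le fun w hw => ⟨(hF w hw).1, (hF w hw).2 ▸ hq⟩)

theorem exists_le_length (hu : IsEnumeration o h u) (hz : z ≠ o) (hh : 0 < h) (M : ℕ) :
    ∃ R, ∀ r ≥ R, M ≤ (u r).length := by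
  have : List.replicate M z ∈ Set.range u := by
    rw [hu.range_eq]
    exact noRun_replicate hz hh M
  obtain ⟨R, hR⟩ := this
  exact ⟨R, fun r hr => by simpa [hR] using hu.monotone hr⟩

/-- The lengths tend to infinity, hence so do their averages: from some `R` on they are at least `2
* M`, and for `r ≥ 2 * R` this concerns at least half of the terms. -/
theorem exists_mul_le_sum (hu : IsEnumeration o h u) (hz : z ≠ o) (hh : 0 < h) (M : ℕ) :
    ∃ R, ∀ r ≥ R, M * r ≤ ∑ i ∈ Finset.range r, (u i).length := by
  obtain ⟨R, hR⟩ := hu.exists_le_length hz hh (2 * M)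
  refine ⟨2 * R, fun r hr => ?_⟩
  obtain ⟨s, rfl⟩ : ∃ s, r = R + s := ⟨r - R, by omega⟩
  rw [Finset.sum_range_add]
  have h1 : ∑ i ∈ Finset.range s, 2 * M ≤ ∑ i ∈ Finset.range s, (u (R + i)).length :=
    Finset.sum_le_sum fun i _ => hR _ (Nat.le_add_right _ _)
  rw [Finset.sum_const, Finset.card_range, smul_eq_mul] at h1
  have h2 : M * R ≤ M * s := Nat.mul_le_mul_left _ (by omega)
  rw [Nat.mul_add]
  have h3 : s * (2 * M) = 2 * (M * s) := by ring
  rw [h3] at h1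
  omega

end IsEnumeration

end
end Palindrome

/-! ### The palindrome sequence, its LZ parsing and the two estimates -/

namespace Palindrome

section
variable {A : Type*} (o z : A) (h : ℕ)

/-- The phrases `z`, `zo`, ..., `zo^h`. -/
def startPhrases : List (List A) := (List.range (h + 1)).map fun j => z :: .replicate j o

/-- The palindrome with first half `u`, consisting of the two phrases `o u` and `z o^h z u⁻¹`. -/
def palindrome (u : List A) : List A := o :: u ++ (z :: .replicate h o ++ z :: u.reverse)

/-- The phrases of a concatenation of palindromes. -/
def phrases (us : List (List A)) : List (List A) :=
  startPhrases o z h ++ us.flatMap fun u => [o :: u, z :: .replicate h o ++ z :: u.reverse]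

variable {o z h}

theorem flatten_phrases (us : List (List A)) :
    (phrases o z h us).flatten =
      (startPhrases o z h).flatten ++ (us.map (palindrome o z h)).flatten := by
  rw [phrases, List.flatten_append]
  congr 1
  induction us with
  | nil => rfl
  | cons u us ih =>
    rw [List.flatMap_cons, List.flatten_append, ih]
    simp [palindrome]

theorem length_palindrome (u : List A) :
    (palindrome o z h u).length = 2 * u.length + (h + 3) := by
  simp [palindrome]
  omega

theorem phrases_concat (us : List (List A)) (u : List A) :
    phrases o z h (us ++ [u]) =
      phrases o z h us ++ [o :: u] ++ [z :: .replicate h o ++ z :: u.reverse] := by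
  simp [phrases]

theorem length_phrases (us : List (List A)) :
    (phrases o z h us).length = h + 1 + 2 * us.length := by
  simp [phrases, startPhrases, List.length_flatMap, mul_comm]

theorem mem_phrases {us : List (List A)} {p : List A} :
    p ∈ phrases o z h us ↔ (∃ j ≤ h, z :: .replicate j o = p) ∨
      ∃ u ∈ us, p = o :: u ∨ p = z :: .replicate h o ++ z :: u.reverse := by
  simp [phrases, startPhrases]

theorem isLZParsing_startPhrases (n : ℕ) :
    IsLZParsing ((List.range n).map fun j => z :: .replicate j o) := by
  induction n with
  | zero => exact .nil
  | succ n ih =>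
    rw [List.range_succ, List.map_append]
    refine .snoc ih (by simp) ?_ ?_
    · intro hmem
      obtain ⟨j, hj, hj'⟩ := List.mem_map.1 hmem
      have := congrArg List.length hj'
      simp at this hj
      omega
    · cases n with
      | zero => left; rfl
      | succ n =>
        right
        refine List.mem_map.2 ⟨n, by simp, ?_⟩
        change _ = (z :: List.replicate (n + 1) o).dropLast
        rw [List.replicate_succ', ← List.cons_append, List.dropLast_concat]

/-- Deleting the last symbol of `o u` shortens `u` at its end; deleting the last symbol of `z o^h z
u⁻¹` shortens `u` at its beginning. Both shorter words still have no long run, so they were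
enumerated earlier. The phrases are new because `u` is injective, and the two kinds differ in their
first symbol. -/
theorem isLZParsing_phrases (hz : z ≠ o) {u : ℕ → List A} (hu : IsEnumeration o h u) (r : ℕ) :
    IsLZParsing (phrases o z h (seqPrefix u r)) := by
  induction r with
  | zero => simpa [phrases, startPhrases, seqPrefix] using isLZParsing_startPhrases (h + 1)
  | succ r ih =>
    have hnot : ∀ i < r, u i ≠ u r := fun i hi h => hi.ne (hu.injective h)
    rw [seqPrefix_succ, phrases_concat]
    refine .snoc (.snoc ih (by simp) ?_ ?_) (by simp) ?_ ?_
    · intro hmem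
      rcases mem_phrases.1 hmem with ⟨j, -, hj⟩ | ⟨v, hv, hv' | hv'⟩
      · exact hz (List.cons.inj hj).1
      · obtain ⟨i, hi, rfl⟩ := mem_seqPrefix.1 hv
        exact hnot i hi (List.cons.inj hv').2.symm
      · exact hz (List.cons.inj hv').1.symm
    · by_cases hr : u r = []
      · left; rw [hr]; rfl
      · right
        obtain ⟨j, hj, hj'⟩ := hu.exists_lt (i := r) (w := (u r).dropLast)
          ((hu.noRun r).of_infix (List.dropLast_prefix _).isInfix)
          (by have := List.length_pos_iff.2 hr; simp; omega)
        refine mem_phrases.2 (.inr ⟨u j, mem_seqPrefix.2 ⟨j, hj, rfl⟩, .inl ?_⟩)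
        rw [hj', List.dropLast_cons_of_ne_nil hr]
    · intro hmem
      rcases List.mem_append.1 hmem with hmem | hmem
      · rcases mem_phrases.1 hmem with ⟨j, hj, hj'⟩ | ⟨v, hv, hv' | hv'⟩
        · have := congrArg List.length hj'
          simp at this
          omega
        · exact hz (List.cons.inj hv').1
        · obtain ⟨i, hi, rfl⟩ := mem_seqPrefix.1 hv
          have := List.append_cancel_left hv'
          exact hnot i hi (List.reverse_injective (List.cons.inj this).2).symm
      · exact hz (List.cons.inj (List.mem_singleton.1 hmem)).1
    · right
      apply List.mem_append_left
      rw [mem_phrases]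
      cases hr : u r with
      -- For empty `u` the parent is `z o^h`; the start phrases exist to provide it.
      | nil => exact .inl ⟨h, le_rfl, List.dropLast_concat.symm⟩
      | cons a v =>
        obtain ⟨j, hj, hj'⟩ := hu.exists_lt (i := r) (w := v)
          ((hu.noRun r).of_infix (hr ▸ (List.suffix_cons a v).isInfix)) (by simp [hr])
        refine .inr ⟨u j, mem_seqPrefix.2 ⟨j, hj, rfl⟩, .inr ?_⟩
        rw [hj', List.reverse_cons, ← List.cons_append, ← List.append_assoc, List.dropLast_concat]

/-- The concatenation of all palindromes whose first halves have no long runs. -/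
def IsPalindromeSequence (o z : A) (h : ℕ) (u : ℕ → List A) (S : ℕ → A) : Prop :=
  ∀ r, seqPrefix S (phrases o z h (seqPrefix u r)).flatten.length =
    (phrases o z h (seqPrefix u r)).flatten

theorem flatten_phrases_succ (u : ℕ → List A) (r : ℕ) :
    (phrases o z h (seqPrefix u (r + 1))).flatten =
      (phrases o z h (seqPrefix u r)).flatten ++ palindrome o z h (u r) := by
  rw [flatten_phrases, flatten_phrases, seqPrefix_succ]
  simp

theorem length_flatten_phrases (u : ℕ → List A) (r : ℕ) :
    (phrases o z h (seqPrefix u r)).flatten.length = (startPhrases o z h).flatten.length +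
      ∑ i ∈ Finset.range r, (2 * (u i).length + (h + 3)) := by
  induction r with
  | zero => simp [flatten_phrases, seqPrefix]
  | succ r ih =>
    rw [flatten_phrases_succ, List.length_append, ih, Finset.sum_range_succ, length_palindrome,
      add_assoc]

theorem exists_isPalindromeSequence (o z : A) (h : ℕ) (u : ℕ → List A) :
    ∃ S, IsPalindromeSequence o z h u S := by
  refine exists_seqPrefix_eq (fun r => (phrases o z h (seqPrefix u r)).flatten) (fun r => ?_)
    fun r => ?_
  · rw [flatten_phrases_succ]
    exact List.prefix_append _ _
  · rw [length_flatten_phrases]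
    have : ∑ i ∈ Finset.range r, 1 ≤ ∑ i ∈ Finset.range r, (2 * (u i).length + (h + 3)) :=
      Finset.sum_le_sum fun i _ => by omega
    rw [Finset.sum_const, Finset.card_range, smul_eq_mul, mul_one] at this
    exact this.trans (Nat.le_add_left _ _)

/-- Every long prefix of a palindrome sequence consists of many phrases and a part of the next
palindrome. -/
theorem IsPalindromeSequence.exists_eq {u : ℕ → List A} {S : ℕ → A}
    (hS : IsPalindromeSequence o z h u S) (R : ℕ) :
    ∃ N₀, ∀ N ≥ N₀, ∃ r ≥ R, ∃ t, seqPrefix S N = (phrases o z h (seqPrefix u r)).flatten ++ t ∧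
      t.length ≤ 2 * (u r).length + (h + 3) := by
  set X : ℕ → List A := fun r => (phrases o z h (seqPrefix u r)).flatten with hX
  have hXs : ∀ r, (X (r + 1)).length = (X r).length + (2 * (u r).length + (h + 3)) := fun r => by
    simp only [hX, flatten_phrases_succ, List.length_append, length_palindrome]
  have hmono : StrictMono fun r => (X r).length :=
    strictMono_nat_of_lt_succ fun r => by rw [hXs]; omega
  refine ⟨(X R).length, fun N hN => ?_⟩
  -- The lengths increase strictly, so `r = N` is large enough; the least such `r` counts the
  -- complete palindromes.
  have hex : ∃ r, N < (X (r + 1)).length := ⟨N, (Nat.lt_succ_self N).trans_le (hmono.id_le _)⟩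
  classical
  set r := Nat.find hex with hr
  have h1 : N < (X (r + 1)).length := Nat.find_spec hex
  have h2 : R ≤ r := by
    by_contra! hlt
    have : (X (r + 1)).length ≤ (X R).length := hmono.monotone (Nat.succ_le_of_lt hlt)
    omega
  have h3 : (X r).length ≤ N := by
    rcases Nat.eq_zero_or_pos r with h0 | h0
    · rw [h0]
      exact (hmono.monotone (Nat.zero_le R)).trans hN
    · have := Nat.find_min hex (m := r - 1) (by omega)
      rw [Nat.sub_add_cancel h0] at this
      omega
  obtain ⟨t, ht⟩ := seqPrefix_prefix S h3
  rw [hS r] at ht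
  refine ⟨r, h2, t, ht.symm, ?_⟩
  have h4 := congrArg List.length ht
  rw [length_seqPrefix, List.length_append] at h4
  rw [hXs] at h1
  simp only [hX] at h1 h3
  omega

/-- The compressor shortens palindrome sequences almost by half. -/
theorem IsPalindromeSequence.length_output_le [Fintype A] {u : ℕ → List A} {S : ℕ → A}
    (hS : IsPalindromeSequence o z h u S) (hu : IsEnumeration o h u) (hz : z ≠ o) (hh : 0 < h)
    {V : ℕ} (hV : 0 < V) :
    ∃ (C : BoundedPDT A A) (D : BoundedPDT (A ⊕ C.Q) A), IsInvPD C D ∧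
      ∃ N₀, ∀ N ≥ N₀, 2 * V * (C.output (seqPrefix S N)).length ≤ (V + 2) * N := by
  set s := (startPhrases o z h).flatten.length with hs
  set B := V + h + s with hB
  refine ⟨compressor o z h V s B, decompressor o z h V s B, isInvPD o z h V s B hz, ?_⟩
  -- `K * r` bounds all lower-order costs: the start, the constant overhead per palindrome, and the
  -- incomplete palindrome `t`, whose length is at most `(h + 5) * r`. For large `r`, `V * K * r` is
  -- at most the total length `σ` of the first halves.
  set K := s + (h + 4) + (B + 2) * (h + 5) with hK
  obtain ⟨R, hR⟩ := hu.exists_mul_le_sum hz hh (V * K)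
  obtain ⟨N₀, hN₀⟩ := hS.exists_eq (R + 1)
  refine ⟨N₀, fun N hN => ?_⟩
  obtain ⟨r, hr, t, ht, htl⟩ := hN₀ N hN
  have h1 := length_compressor_output_le (B := B) hz hh (by omega) hV (by omega) hs.symm
    (by simp [startPhrases, List.range_succ]) (us := seqPrefix u r) (fun w hw => by
      obtain ⟨i, -, rfl⟩ := mem_seqPrefix.1 hw
      exact hu.noRun i) t
  have h2 : seqPrefix S N = (startPhrases o z h).flatten ++ ((seqPrefix u r).map fun u =>
      o :: u ++ (z :: .replicate h o ++ z :: u.reverse)).flatten ++ t := by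
    rw [ht, flatten_phrases]
    rfl
  rw [← h2, sum_map_seqPrefix u fun v => v.length + h + 3 + (v.length + 1) / V] at h1
  have h3 := congrArg List.length ht
  rw [length_seqPrefix, List.length_append, length_flatten_phrases, Finset.sum_add_distrib,
    ← Finset.mul_sum] at h3
  set σ := ∑ i ∈ Finset.range r, (u i).length with hσ
  have h4 : V * ∑ i ∈ Finset.range r, ((u i).length + h + 3 + ((u i).length + 1) / V) ≤
      (V + 1) * σ + V * (h + 4) * r := by
    rw [Finset.mul_sum, hσ, Finset.mul_sum]
    have : V * (h + 4) * r = ∑ i ∈ Finset.range r, V * (h + 4) := by simp [mul_comm]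
    rw [this, ← Finset.sum_add_distrib]
    refine Finset.sum_le_sum fun i _ => ?_
    have := Nat.mul_div_le ((u i).length + 1) V
    nlinarith
  have h5 := hR r (by omega)
  have h6 : (B + 2) * t.length ≤ (B + 2) * (h + 5) * r := by
    have h7 := hu.length_le hz hh r
    rw [mul_assoc]
    exact Nat.mul_le_mul_left _ (by nlinarith)
  have h8 : s ≤ s * r := Nat.le_mul_of_pos_right _ (by omega)
  have h9 : V * ((compressor o z h V s B).output (seqPrefix S N)).length ≤ (V + 2) * σ := by
    calc _ ≤ V * (s * r + ∑ i ∈ Finset.range r, ((u i).length + h + 3 + ((u i).length + 1) / V) +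
          (B + 2) * (h + 5) * r) := Nat.mul_le_mul_left _ (by omega)
      _ ≤ V * K * r + (V + 1) * σ := by
        rw [hK]
        nlinarith
      _ ≤ (V + 2) * σ := by linarith
  have h10 : (V + 2) * (2 * σ) ≤ (V + 2) * N := Nat.mul_le_mul_left _ (by omega)
  linarith

theorem IsPalindromeSequence.le_length_lzOutput [Fintype A] [DecidableEq A] {u : ℕ → List A}
    {S : ℕ → A} (hS : IsPalindromeSequence o z h u S) (hu : IsEnumeration o h u) (hz : z ≠ o)
    (hh : 2 ≤ h) :
    ∃ N₀, ∀ N ≥ N₀, ∀ code : ℕ → List A, IsPrefixFreeCode code →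
      (h - 2) * N ≤ h * (lzOutput code (seqPrefix S N)).length := by
  have : Nontrivial A := ⟨z, o, hz⟩
  set s := (startPhrases o z h).flatten.length with hs
  -- The threshold makes both `q` and `r` at least `s + 8 * h + 10`, which the final polynomial
  -- inequality needs.
  obtain ⟨R, hR⟩ := hu.exists_le_length hz (by omega) (h * (s + 8 * h + 10) + 1)
  obtain ⟨N₀, hN₀⟩ := hS.exists_eq (R + s + 8 * h + 10)
  refine ⟨N₀, fun N hN code hc => ?_⟩
  obtain ⟨r, hr, t, ht, htl⟩ := hN₀ N hN
  have hcode : Function.Injective code := fun i j hij => hc i j (hij ▸ List.prefix_rfl)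
  have ha := hR r (by omega)
  set a := (u r).length with ha'
  -- The largest `q` with `h * q < a`, as `pow_le` requires a strict inequality.
  set q := (a - 1) / h with hq
  have h1 : h * q ≤ a - 1 := Nat.mul_div_le _ _
  have h2 : a - 1 < h * q + h := by
    have := Nat.lt_mul_div_succ (a - 1) (show 0 < h by omega)
    rwa [Nat.mul_add, mul_one] at this
  have hqD : s + 8 * h + 10 ≤ q := by
    rw [hq, Nat.le_div_iff_mul_le (by omega)]
    rw [mul_comm]
    omega
  have h3 := hu.pow_le hz (by omega) (i := r) (q := q) (by omega)
  -- Using `q - 1` instead of `q` gains a factor `k^(h-1) ≥ h`, where `k` is the size of the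
  -- alphabet. So the `k^L` words that may be short, for `L = (h - 1) * (q - 1)`, are at most a
  -- fraction `1/h` of `r`.
  have h4 : h * Fintype.card A ^ ((h - 1) * (q - 1)) ≤ r := by
    refine le_trans ?_ h3
    have : (h - 1) * q = (h - 1) + (h - 1) * (q - 1) := by
      obtain ⟨q', hq'⟩ : ∃ q', q = q' + 1 := ⟨q - 1, by omega⟩
      rw [hq']
      simp [Nat.mul_add, add_comm]
    rw [this, pow_add]
    refine Nat.mul_le_mul_right _ ?_
    have h5 : h - 1 < 2 ^ (h - 1) := Nat.lt_two_pow_self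
    have h6 : 2 ^ (h - 1) ≤ Fintype.card A ^ (h - 1) :=
      Nat.pow_le_pow_left Fintype.one_lt_card _
    omega
  have h5 := (isLZParsing_phrases hz hu r).le_length_lzOutput hcode ((h - 1) * (q - 1)) t
  rw [← ht, length_phrases, length_seqPrefix] at h5
  have h6 := congrArg List.length ht
  rw [length_seqPrefix, List.length_append, length_flatten_phrases] at h6
  have h7 : ∑ i ∈ Finset.range r, (2 * (u i).length + (h + 3)) ≤ r * (2 * a + (h + 3)) := by
    calc _ ≤ ∑ i ∈ Finset.range r, (2 * a + (h + 3)) := Finset.sum_le_sum fun i hi => by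
          have := hu.monotone (Finset.mem_range.1 hi).le
          simp only at this
          omega
      _ = _ := by simp
  have h8 : N ≤ s + (r + 1) * (2 * (h * q) + (3 * h + 3)) := by
    have : (r + 1) * (2 * a + (h + 3)) ≤ (r + 1) * (2 * (h * q) + (3 * h + 3)) :=
      Nat.mul_le_mul_left _ (by omega)
    rw [Nat.add_mul, one_mul] at this
    omega
  generalize (lzOutput code (seqPrefix S N)).length = out at h5 ⊢
  -- For large `q` and `r` this gives a ratio near `(2h-1)(h-1)/(2h²)`, which exceeds `1 - 2/h`; the
  -- gap absorbs the lower-order terms.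
  have h9 : (2 * h - 1) * r * ((h - 1) * (q - 1)) ≤ h * out := by
    refine le_trans ?_ (Nat.mul_le_mul_left h h5)
    rw [← mul_assoc h]
    refine Nat.mul_le_mul_right _ ?_
    rw [Nat.mul_sub, Nat.sub_mul, one_mul]
    have : h * (h + 1 + 2 * r) = h * (h + 1) + 2 * h * r := by ring
    omega
  refine le_trans ((Nat.mul_le_mul_left _ h8).trans ?_) h9
  clear h1 h2 h3 h4 h5 h6 h7 h8 h9 ha htl ht hN hcode hc hN₀ hR
  clear_value s a q
  have hrD : s + 8 * h + 10 ≤ r := by omega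
  clear hr hS
  obtain ⟨h, rfl⟩ : ∃ h', h = h' + 2 := ⟨h - 2, by omega⟩
  obtain ⟨q, rfl⟩ := Nat.exists_eq_add_of_le hqD
  obtain ⟨r, rfl⟩ := Nat.exists_eq_add_of_le hrD
  have e1 : 2 * (h + 2) - 1 = 2 * h + 3 := by omega
  have e2 : s + 8 * (h + 2) + 10 + q - 1 = s + 8 * h + 25 + q := by omega
  rw [e1, e2, Nat.add_sub_cancel, show h + 2 - 1 = h + 1 by omega]
  -- After `h`, `q` and `r` are shifted by their lower bounds, the difference of the two sides is a
  -- polynomial with nonnegative coefficients, written out here.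
  refine le_of_le_of_eq (Nat.le_add_right _ ((h + 3) * q * r +
    ((h + 3) * s + 3 * h ^ 2 + 36 * h + 75) * r + ((h + 3) * s + 6 * h ^ 2 + 46 * h + 78) * q +
    ((h + 3) * s * (s + 8 * h) + 78 * s + 25 * h * s + h ^ 2 * (s + 8 * h + 23) +
      32 * h * (s + 8 * h) + 823 * h + 75 * (s + 8 * h + 26)))) ?_
  ring

end

end Palindrome

/-! ### Passing to the limit -/

theorem theorem5 {A : Type*} [Fintype A] [DecidableEq A] [Nontrivial A] (ε : ℝ) (hε : 0 < ε) :
    ∃ S : ℕ → A,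
      upperRatioInvPD S ≤ ((1 / 2 : ℝ) : EReal) ∧
      ∀ code : ℕ → List A, IsPrefixFreeCode code →
        ((1 - ε : ℝ) : EReal) < lowerRatio (lzOutput code) S := by
  obtain ⟨z, o, hz⟩ := exists_pair_ne A
  obtain ⟨n, hn⟩ := exists_nat_gt (2 / ε)
  -- This gives `h ≥ 2` and `2 / h < ε`.
  set h := n + 2 with hh
  obtain ⟨u, hu⟩ := Palindrome.exists_isEnumeration hz (show 0 < h by omega)
  obtain ⟨S, hS⟩ := Palindrome.exists_isPalindromeSequence o z h u
  refine ⟨S, ?_, fun code hc => ?_⟩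
  -- Blocks of length at least `V = n + 1` give the ratio `(V + 2) / (2V) = 1/2 + 1/V`; each `n`
  -- uses another compressor, for the same sequence.
  · have key : ∀ n : ℕ, upperRatioInvPD S ≤ ((1 / 2 + 1 / ((n : ℝ) + 1) : ℝ) : EReal) := by
      intro n
      obtain ⟨C, D, hCD, N₀, hN₀⟩ := hS.length_output_le hu hz (by omega) n.succ_pos
      refine (sInf_le ⟨C, D, hCD, rfl⟩ : upperRatioInvPD S ≤ upperRatio C.output S).trans
        (limsup_le_of_le (h := ?_))
      filter_upwards [eventually_ge_atTop (max N₀ 1)] with N hN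
      have h1 := hN₀ N (le_of_max_le_left hN)
      have hN1 : (0 : ℝ) < N := by exact_mod_cast lt_of_lt_of_le one_pos (le_of_max_le_right hN)
      have h2 : (2 * (n + 1) * (C.output (seqPrefix S N)).length : ℝ) ≤ (n + 1 + 2) * N := by
        exact_mod_cast h1
      rw [prefixRatio, EReal.coe_le_coe_iff, div_le_iff₀ hN1]
      have h3 : (1 / 2 + 1 / ((n : ℝ) + 1)) * N = (n + 1 + 2) * N / (2 * (n + 1)) := by
        field_simp
      rw [h3, le_div_iff₀ (by positivity)]
      linarith
    have hlim : Tendsto (fun n : ℕ => ((1 / 2 + 1 / ((n : ℝ) + 1) : ℝ) : EReal)) atTop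
        (nhds ((1 / 2 : ℝ) : EReal)) := by
      refine (continuous_coe_real_ereal.tendsto _).comp ?_
      have := (tendsto_one_div_add_atTop_nhds_zero_nat (𝕜 := ℝ)).const_add (1 / 2)
      rwa [add_zero] at this
    exact ge_of_tendsto' hlim key
  · obtain ⟨N₀, hN₀⟩ := hS.le_length_lzOutput hu hz (by omega)
    have hh0 : (0 : ℝ) < h := by exact_mod_cast (show 0 < h by omega)
    have h1 : ((1 - ε : ℝ) : EReal) < ((1 - 2 / h : ℝ) : EReal) := by
      rw [EReal.coe_lt_coe_iff]
      have h2 : 2 / ε < h := hn.trans (by exact_mod_cast (show n < h by omega))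
      have h3 : 2 / (h : ℝ) < ε := by
        rw [div_lt_iff₀ hε] at h2
        rw [div_lt_iff₀ hh0]
        linarith
      linarith
    refine h1.trans_le (le_liminf_of_le (h := ?_))
    filter_upwards [eventually_ge_atTop (max N₀ 1)] with N hN
    have h2 := hN₀ N (le_of_max_le_left hN) code hc
    have hN1 : (0 : ℝ) < N := by exact_mod_cast lt_of_lt_of_le one_pos (le_of_max_le_right hN)
    have h3 : ((h : ℝ) - 2) * N ≤ h * (lzOutput code (seqPrefix S N)).length := by
      rw [← Nat.cast_ofNat, ← Nat.cast_sub (show 2 ≤ h by omega)]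
      exact_mod_cast h2
    rw [prefixRatio, EReal.coe_le_coe_iff, le_div_iff₀ hN1]
    have h4 : (1 - 2 / (h : ℝ)) * N = (h - 2) * N / h := by
      field_simp
    rw [h4, div_le_iff₀ hh0]
    linarith
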